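/- Let $P_1,P_2\in\mathbb R[s]$ with $\deg P_1=\deg P_2=1$ and leading coefficients $p_{d_1},p_{d_2}$, let $A_1(x)=a_{10}+a_{11}x+a_{12}x^2$, $A_2(x)=a_{20}+a_{21}x$ be real polynomials and $A_3\in\mathbb R$. Consider on $\mathbb R^3$ the differential system $\dot x=F_1$, $\dot y=F_2$, $\dot z=F_3$ with $$F_1(x,y)=P_1\big(y+A_1(x)\big),\qquad F_2(x,y,z)=P_2\Big(z+\tfrac{1}{p_{d_2}}A_2(x)\Big)-A_1'(x)F_1(x,y),$$ $$F_3(x,y)=-\tfrac1{p_{d_2}}\Big[-\tfrac12A_1''(x)F_1(x,y)^2+A_2'(x)F_1(x,y)\Big]+A_3 .$$ A trajectory is a solution on its maximal interval of existence. It goes to infinity in forward (backward) time if it eventually leaves every compact set as $t$ tends to the right (left) end of that interval. 1. If $\deg A_1\le 1$ (i.e. $a_{12}=0$), then every nontrivial (nonconstant) trajectory goes to infinity in forward and backward time. 2. If $\deg A_1=2$, put $\mu:=A_3\,a_{12}\,p_{d_2}\,p_{d_1}^2$. (a) If $\mu>0$, then every trajectory goes to infinity in forward and backward time. (b) If $\mu=0$,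 then there is a unique cuspidal invariant surface $\mathcal S_0$ of the system, and every trajectory in $\mathbb R^3\setminus\mathcal S_0$ goes to infinity in forward and backward time. Here a cuspidal invariant surface is an invariant algebraic surface, i.e. the zero set of a nonconstant polynomial $f\in\mathbb R[x,y,z]$ with $F_1f_x+F_2f_y+F_3f_z=Kf$ for some $K\in\mathbb R[x,y,z]$, that some $C^\infty$ diffeomorphism of $\mathbb R^3$ maps onto the cylinder $\mathbb R\times\{(y,z):z^2=y^3\}$ over the cuspidal cubic. (c) If $\mu<0$, then there is a unique isochronous periodic surface $\mathcal S_\mu$ of the system; it is homeomorphic to the cylinder $\mathbb R\times\mathbb S^1$, and every trajectory in $\mathbb R^3\setminus\mathcal S_\mu$ goes to infinity in forward and backward time. Here a periodic surface is a nonempty closed embedded $C^\infty$ two-dimensional submanifold of $\mathbb R^3$ (without boundary) foliated by (nonconstant) periodic orbits of the system; it is isochronous if all its periodic orbits have the same minimal period. -/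

import Mathlib

open scoped ContDiff

noncomputable section

namespace NilpotentField

/-- Phase space `ℝ³`, with coordinates `x = p 0`, `y = p 1`, `z = p 2`. -/
abbrev Space : Type := Fin 3 → ℝ

/-- The first component `F₁(x,y) = P₁(y + A₁(x))`. -/
def F₁ (P₁ A₁ : Polynomial ℝ) (x y : ℝ) : ℝ :=
  P₁.eval (y + A₁.eval x)

/-- The second component
`F₂(x,y,z) = P₂(z + A₂(x) / (d₂ p_{d₂})) - A₁'(x) F₁(x,y)`. -/
def F₂ (P₁ P₂ A₁ A₂ : Polynomial ℝ) (x y z : ℝ) : ℝ :=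
  P₂.eval (z + 1 / (P₂.natDegree * P₂.leadingCoeff) * A₂.eval x)
    - A₁.derivative.eval x * F₁ P₁ A₁ x y

/-- The third component
`F₃(x,y) = -(1 / (d₂ p_{d₂})) [-(1/2) A₁''(x) F₁(x,y)² + A₂'(x) F₁(x,y)] + A₃`. -/
def F₃ (P₁ P₂ A₁ A₂ : Polynomial ℝ) (A₃ : ℝ) (x y : ℝ) : ℝ :=
  -(1 / (P₂.natDegree * P₂.leadingCoeff))
      * (-(1 / 2) * A₁.derivative.derivative.eval x * (F₁ P₁ A₁ x y) ^ 2
          + A₂.derivative.eval x * F₁ P₁ A₁ x y)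
    + A₃

/-- The vector field `F = (F₁, F₂, F₃)` on `ℝ³`. -/
def field (P₁ P₂ A₁ A₂ : Polynomial ℝ) (A₃ : ℝ) (p : Space) : Space :=
  ![F₁ P₁ A₁ (p 0) (p 1), F₂ P₁ P₂ A₁ A₂ (p 0) (p 1) (p 2),
    F₃ P₁ P₂ A₁ A₂ A₃ (p 0) (p 1)]

/-- `γ` solves `γ' = F(γ)` on the nonempty open interval `I`
(possibly unbounded; the values of `γ` outside `I` are irrelevant). -/
structure IsSolutionOn (F : Space → Space) (γ : ℝ → Space) (I : Set ℝ) : Prop where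
  isOpen : IsOpen I
  ordConnected : I.OrdConnected
  nonempty : I.Nonempty
  hasDerivAt : ∀ t ∈ I, HasDerivAt γ (F (γ t)) t

/-- A trajectory of `F`: a solution with its maximal interval of existence `I`. -/
structure IsTrajectory (F : Space → Space) (γ : ℝ → Space) (I : Set ℝ) : Prop
    extends IsSolutionOn F γ I where
  maximal : ∀ (δ : ℝ → Space) (J : Set ℝ), IsSolutionOn F δ J → I ⊆ J → Set.EqOn γ δ I → J ⊆ I

/-- The trajectory is not reduced to a point. -/
def IsNontrivial (γ : ℝ → Space) (I : Set ℝ) : Prop :=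
  ∃ s ∈ I, ∃ t ∈ I, γ s ≠ γ t

/-- `γ` goes to infinity in forward and in backward time: it leaves every compact set for good
as `t` tends to the right end and to the left end of its interval `I`. -/
def EscapesBothWays (γ : ℝ → Space) (I : Set ℝ) : Prop :=
  ∀ K : Set Space, IsCompact K →
    (∃ t₀ ∈ I, ∀ t ∈ I, t₀ ≤ t → γ t ∉ K) ∧ (∃ t₀ ∈ I, ∀ t ∈ I, t ≤ t₀ → γ t ∉ K)

/-- `S` is an invariant algebraic surface of the vector field `F`: the zero set of a nonconstant
polynomial `f` with `⟨F, ∇f⟩ = K f` for some polynomial `K` (the cofactor). In particular, this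
covers every level set of every polynomial first integral (`K = 0`). -/
def IsInvariantAlgebraic (F : Space → Space) (S : Set Space) : Prop :=
  ∃ f K : MvPolynomial (Fin 3) ℝ, f.totalDegree ≠ 0 ∧
    S = {p | MvPolynomial.eval p f = 0} ∧
    ∀ p : Space, ∑ i, F p i * MvPolynomial.eval p (MvPolynomial.pderiv i f)
      = MvPolynomial.eval p K * MvPolynomial.eval p f

/-- The standard cuspidal surface `ℝ × {z² = y³}`, the cylinder over the cuspidal cubic. -/
def standardCuspidal : Set Space := {p | (p 2) ^ 2 = (p 1) ^ 3}

/-- `S` is a cuspidal surface: some `C^∞` diffeomorphism of `ℝ³` maps it onto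
`ℝ × {z² = y³}`. -/
def IsCuspidal (S : Set Space) : Prop :=
  ∃ e : Space ≃ Space, ContDiff ℝ ∞ e ∧ ContDiff ℝ ∞ e.symm ∧ e '' S = standardCuspidal

/-- A cuspidal invariant surface of `F`. -/
def IsCuspidalInvariantSurface (F : Space → Space) (S : Set Space) : Prop :=
  IsInvariantAlgebraic F S ∧ IsCuspidal S

/-- A (regular) surface: a nonempty closed subset of `ℝ³` that is locally the zero set of a `C^∞`
function without critical points, i.e. a closed embedded two-dimensional submanifold. -/
def IsRegularSurface (S : Set Space) : Prop :=
  S.Nonempty ∧ IsClosed S ∧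
    ∀ p ∈ S, ∃ U : Set Space, IsOpen U ∧ p ∈ U ∧ ∃ g : Space → ℝ,
      ContDiffOn ℝ ∞ g U ∧ (∀ q ∈ U, fderiv ℝ g q ≠ 0) ∧ S ∩ U = {q ∈ U | g q = 0}

/-- `γ` is a periodic orbit of `F` with (minimal) period `T > 0`. The minimality
excludes equilibria. -/
structure IsPeriodicOrbit (F : Space → Space) (γ : ℝ → Space) (T : ℝ) : Prop where
  hasDerivAt : ∀ t, HasDerivAt γ (F (γ t)) t
  pos : 0 < T
  periodic : Function.Periodic γ T
  minimal : ∀ s, 0 < s → s < T → ¬ Function.Periodic γ s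

/-- A periodic surface of `F`: a surface that is foliated by periodic orbits. -/
def IsPeriodicSurface (F : Space → Space) (S : Set Space) : Prop :=
  IsRegularSurface S ∧
    ∀ p ∈ S, ∃ (γ : ℝ → Space) (T : ℝ), IsPeriodicOrbit F γ T ∧ γ 0 = p ∧ Set.range γ ⊆ S

/-- An isochronous periodic surface: all its periodic orbits have the same period. -/
def IsIsochronousPeriodicSurface (F : Space → Space) (S : Set Space) : Prop :=
  IsPeriodicSurface F S ∧
    ∃ T : ℝ, ∀ (γ : ℝ → Space) (T' : ℝ), IsPeriodicOrbit F γ T' → Set.range γ ⊆ S → T' = T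

/-- `μ = A₃ a₁₂ p_{d₂} p_{d₁}²`, where `a₁₂` is the coefficient of `x²` in `A₁`. -/
def mu (P₁ P₂ A₁ : Polynomial ℝ) (A₃ : ℝ) : ℝ :=
  A₃ * A₁.coeff 2 * P₂.leadingCoeff * P₁.leadingCoeff ^ 2

end NilpotentField

end

namespace NilpotentField

/-! ### Uniqueness and continuation of solutions -/

/-! Write `p`, `q` for the leading coefficients of `P₁`, `P₂` and `e₂ = p a₁₂`. Along a solution,
`x'' / p` is affine in `(x, z)`, and the particular form of `F₃` gives `x''' = e₂ (x')² + p q A₃`.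
Hence `(l x, l x', l x'')` are global polynomial coordinates with polynomial inverse
(`isConj_straighten`), in which the field is `u = x'`, `v = u'`, `v' = a u² + b`. If `a₁₂ = 0` then
`a = 0`; otherwise `l = 2 e₂ / 3` gives `a = 3/2` and `b = 2 μ / 3`. All notions in the statement
are transported by such a conjugation.

A trajectory that does not escape forward returns to a compact set at arbitrarily late times, so it
is defined for all large times. If `v` eventually keeps one sign, then `u` is monotone, and the
first integral makes `v` converge too; a function whose derivative has a nonzero limit cannot stay
bounded along late times, so `u, v → 0` and `b = 0` (`IsSolutionOn.tendsto_of_sign`). This excludes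
`b > 0`, leaves only equilibria for `a = 0`, and for `a = 3/2`, `b = 0` puts returning trajectories
on the zero level of `v² - u³`. Backward time follows from the symmetry `(x, u, v, t) ↦ (-x, u, -v,
-t)`.

If `b < 0`, a returning solution has `v` changing sign forever, so `(u, v)` runs around an oval of a
cubic. An angle parametrizes the oval, and the displacement of `x` over one turn is a multiple of
`drift k`, with `k` the shape of the oval. Since `drift` decreases strictly on `[0, 3)` from
positive to negative values, exactly one oval has no displacement. The cylinder over it consists of
periodic orbits with one common period, all returning trajectories lie on it, and a regular surface
contained in it is the whole cylinder.

If `b = 0`, uniqueness of the cuspidal surface is algebraic. On each level of `v² - u³` a polynomial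
defining an invariant surface is constant (`exists_eval_eq_of_invariant`), so such a surface is a
union of levels. A cuspidal surface is connected with empty interior, hence a single level, and only
the zero level is singular. -/

lemma IsSolutionOn.mono {F : Space → Space} {γ : ℝ → Space} {I J : Set ℝ}
    (h : IsSolutionOn F γ I) (hJo : IsOpen J) (hJc : J.OrdConnected) (hJn : J.Nonempty)
    (hJI : J ⊆ I) : IsSolutionOn F γ J :=
  ⟨hJo, hJc, hJn, fun t ht => h.hasDerivAt t (hJI ht)⟩

/-- On a compact subinterval both solutions stay in one closed ball, which is convex and compact, so
a `C¹` field is Lipschitz there and the Grönwall uniqueness theorem applies. -/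
lemma IsSolutionOn.eqOn {F : Space → Space} (hF : ContDiff ℝ 1 F) {γ δ : ℝ → Space} {I : Set ℝ}
    (hγ : IsSolutionOn F γ I) (hδ : IsSolutionOn F δ I) {t₀ : ℝ} (ht₀ : t₀ ∈ I)
    (h₀ : γ t₀ = δ t₀) : Set.EqOn γ δ I := by
  intro t ht
  have hmin : min t₀ t ∈ I := by rcases min_choice t₀ t with h | h <;> rw [h] <;> assumption
  have hmax : max t₀ t ∈ I := by rcases max_choice t₀ t with h | h <;> rw [h] <;> assumption
  obtain ⟨ε, hε, hεI⟩ := Metric.isOpen_iff.1 hγ.isOpen _ hmin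
  obtain ⟨ρ, hρ, hρI⟩ := Metric.isOpen_iff.1 hγ.isOpen _ hmax
  -- The margins put `t₀` in the open interval `(a, b)`, as the uniqueness theorem requires.
  have ha : min t₀ t - ε / 2 ∈ I :=
    hεI (by rw [Real.ball_eq_Ioo]; constructor <;> linarith)
  have hb : max t₀ t + ρ / 2 ∈ I :=
    hρI (by rw [Real.ball_eq_Ioo]; constructor <;> linarith)
  set a := min t₀ t - ε / 2
  set b := max t₀ t + ρ / 2
  have hI : Set.Icc a b ⊆ I := hγ.ordConnected.out ha hb
  have hcγ : ContinuousOn γ (Set.Icc a b) := fun s hs =>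
    (hγ.hasDerivAt s (hI hs)).continuousAt.continuousWithinAt
  have hcδ : ContinuousOn δ (Set.Icc a b) := fun s hs =>
    (hδ.hasDerivAt s (hI hs)).continuousAt.continuousWithinAt
  obtain ⟨R, hR⟩ := ((isCompact_Icc.image_of_continuousOn hcγ).isBounded.union
    (isCompact_Icc.image_of_continuousOn hcδ).isBounded).subset_closedBall 0
  obtain ⟨K, hK⟩ := (hF.contDiffOn (s := Metric.closedBall 0 R)).exists_lipschitzOnWith
    one_ne_zero (convex_closedBall 0 R) (isCompact_closedBall 0 R)
  have h1 : min t₀ t ≤ t₀ := min_le_left _ _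
  have h2 : min t₀ t ≤ t := min_le_right _ _
  have h3 : t₀ ≤ max t₀ t := le_max_left _ _
  have h4 : t ≤ max t₀ t := le_max_right _ _
  refine ODE_solution_unique_of_mem_Icc (v := fun _ => F) (s := fun _ => Metric.closedBall 0 R)
    (K := K) (t₀ := t₀) (a := a) (b := b) (fun _ _ => hK) ⟨?_, ?_⟩ hcγ
    (fun s hs => hγ.hasDerivAt s (hI (Set.Ioo_subset_Icc_self hs)))
    (fun s hs => hR (Or.inl ⟨s, Set.Ioo_subset_Icc_self hs, rfl⟩)) hcδ
    (fun s hs => hδ.hasDerivAt s (hI (Set.Ioo_subset_Icc_self hs)))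
    (fun s hs => hR (Or.inr ⟨s, Set.Ioo_subset_Icc_self hs, rfl⟩)) h₀ ⟨?_, ?_⟩
  all_goals simp only [a, b]; linarith

/-- `γ` returns to some compact set arbitrarily late in `I`. -/
def ReturnsForward (γ : ℝ → Space) (I : Set ℝ) : Prop :=
  ∃ K : Set Space, IsCompact K ∧ ∀ t₀ ∈ I, ∃ t ∈ I, t₀ ≤ t ∧ γ t ∈ K

/-- A trajectory that does not escape in forward time is defined for all large times. -/
lemma IsTrajectory.Ici_subset {F : Space → Space} (hF : ContDiff ℝ 1 F) {γ : ℝ → Space}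
    {I : Set ℝ} (h : IsTrajectory F γ I) (hr : ReturnsForward γ I) {t₀ : ℝ} (ht₀ : t₀ ∈ I) :
    Set.Ici t₀ ⊆ I := by
  obtain ⟨K, hK, hret⟩ := hr
  by_contra hcon
  obtain ⟨b, hb, hbI⟩ := Set.not_subset.1 hcon
  have hIb : ∀ t ∈ I, t < b := fun t ht => by
    by_contra hle
    exact hbI (h.ordConnected.out ht₀ ht ⟨hb, not_lt.1 hle⟩)
  have hne : I.Nonempty := h.nonempty
  have hbdd : BddAbove I := ⟨b, fun t ht => (hIb t ht).le⟩
  set T := sSup I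
  have hTI : T ∉ I := by
    intro hT
    obtain ⟨ε, hε, hεI⟩ := Metric.isOpen_iff.1 h.isOpen _ hT
    have h1 : T + ε / 2 ∈ I := hεI (by rw [Real.ball_eq_Ioo]; constructor <;> linarith)
    have h2 : T + ε / 2 ≤ T := le_csSup hbdd h1
    linarith
  have hlt : ∀ t ∈ I, t < T := fun t ht =>
    lt_of_le_of_ne (le_csSup hbdd ht) (fun e => hTI (e ▸ ht))
  -- If `I` ended at `T`, the returns to `K` would accumulate at `T`. Near a limit point of the
  -- returns Picard–Lindelöf gives a uniform existence time `ε`, so restarting at a return within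
  -- `ε` of `T` continues the solution past `T`, against maximality.
  have happ : ∀ n : ℕ, ∃ t ∈ I, T - 1 / ((n : ℝ) + 1) < t ∧ γ t ∈ K := fun n => by
    have hpos : (0 : ℝ) < 1 / ((n : ℝ) + 1) := by positivity
    obtain ⟨s, hs, hs'⟩ := exists_lt_of_lt_csSup hne (show T - 1 / ((n : ℝ) + 1) < T by linarith)
    obtain ⟨t, ht, hst, htK⟩ := hret s hs
    exact ⟨t, ht, hs'.trans_le hst, htK⟩
  choose τ hτI hτ hτK using happ
  obtain ⟨x₀, -, φ, hφ, hlim⟩ := hK.tendsto_subseq hτK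
  obtain ⟨r, hr, ε, hε, hex⟩ :=
    (hF.contDiffAt (x := x₀)).exists_forall_mem_closedBall_exists_eq_forall_mem_Ioo_hasDerivAt 0
  have e1 : ∀ᶠ n in Filter.atTop, γ (τ (φ n)) ∈ Metric.closedBall x₀ r :=
    hlim.eventually (Metric.closedBall_mem_nhds x₀ hr)
  have e2 : ∀ᶠ n in Filter.atTop, 1 / (((φ n : ℕ) : ℝ) + 1) < ε :=
    (tendsto_one_div_add_atTop_nhds_zero_nat.comp hφ.tendsto_atTop).eventually (gt_mem_nhds hε)
  obtain ⟨n, hn1, hn2⟩ := (e1.and e2).exists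
  set s := τ (φ n)
  have hs : s ∈ I := hτI _
  have hsT : T < s + ε := by have := hτ (φ n); simp only [s]; linarith
  obtain ⟨α, hα0, hα⟩ := hex (γ s) hn1
  have hsol : IsSolutionOn F (fun t => α (t - s)) (Set.Ioo (s - ε) (s + ε)) := by
    refine ⟨isOpen_Ioo, Set.ordConnected_Ioo, ⟨s, by constructor <;> linarith⟩, fun t ht => ?_⟩
    have := hα (t - s) ⟨by linarith [ht.1], by linarith [ht.2]⟩
    exact HasDerivAt.comp_sub_const t s this
  have hgap : Set.EqOn γ (fun t => α (t - s)) (I ∩ Set.Ioo (s - ε) (s + ε)) := by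
    have hsm : s ∈ I ∩ Set.Ioo (s - ε) (s + ε) := ⟨hs, by constructor <;> linarith⟩
    have ho : IsOpen (I ∩ Set.Ioo (s - ε) (s + ε)) := h.isOpen.inter isOpen_Ioo
    have hc : (I ∩ Set.Ioo (s - ε) (s + ε)).OrdConnected := h.ordConnected.inter
      Set.ordConnected_Ioo
    exact IsSolutionOn.eqOn hF (h.toIsSolutionOn.mono ho hc ⟨s, hsm⟩ Set.inter_subset_left)
      (hsol.mono ho hc ⟨s, hsm⟩ Set.inter_subset_right) hsm (by simp [hα0])
  classical
  set δ : ℝ → Space := fun t => if t ∈ I then γ t else α (t - s)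
  have hδ1 : Set.EqOn γ δ I := fun t ht => by simp [δ, ht]
  have hδ2 : Set.EqOn δ (fun t => α (t - s)) (Set.Ioo (s - ε) (s + ε)) := fun t ht => by
    by_cases hI : t ∈ I
    · simpa [δ, hI] using hgap ⟨hI, ht⟩
    · simp [δ, hI]
  have hconn : (I ∪ Set.Ioo (s - ε) (s + ε)).OrdConnected := by
    have h1 : IsPreconnected I := Set.OrdConnected.isPreconnected h.ordConnected
    exact (h1.union s hs (by constructor <;> linarith) isPreconnected_Ioo).ordConnected
  have hJ := h.maximal δ (I ∪ Set.Ioo (s - ε) (s + ε))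
    ⟨h.isOpen.union isOpen_Ioo, hconn, hne.inl, ?_⟩ Set.subset_union_left hδ1
  · exact hTI (hJ (Or.inr ⟨by linarith [hlt s hs], hsT⟩))
  · rintro t (ht | ht)
    · have := h.hasDerivAt t ht
      rw [← hδ1 ht]
      exact this.congr_of_eventuallyEq (by
        filter_upwards [h.isOpen.mem_nhds ht] with y hy using (hδ1 hy).symm)
    · have := hsol.hasDerivAt t ht
      rw [hδ2 ht]
      exact this.congr_of_eventuallyEq (by
        filter_upwards [isOpen_Ioo.mem_nhds ht] with y hy using hδ2 hy)

lemma isTrajectory_univ {F : Space → Space} {γ : ℝ → Space}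
    (h : ∀ t, HasDerivAt γ (F (γ t)) t) : IsTrajectory F γ Set.univ :=
  ⟨⟨isOpen_univ, Set.ordConnected_univ, Set.univ_nonempty, fun t _ => h t⟩,
    fun _ _ _ _ _ => Set.subset_univ _⟩

/-! ### Smooth conjugation -/

/-- The diffeomorphism `e` of `ℝ³` carries the vector field `F` to `G`. -/
structure IsConj (e : Space ≃ Space) (F G : Space → Space) : Prop where
  smooth : ContDiff ℝ ∞ e
  smooth_symm : ContDiff ℝ ∞ e.symm
  fderiv_apply : ∀ p, fderiv ℝ e p (F p) = G (e p)

namespace IsConj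

variable {e : Space ≃ Space} {F G : Space → Space}

lemma hasFDerivAt (h : IsConj e F G) (p : Space) : HasFDerivAt e (fderiv ℝ e p) p :=
  (h.smooth.differentiable (by simp) p).hasFDerivAt

lemma fderiv_symm_comp (h : IsConj e F G) (p : Space) :
    (fderiv ℝ e.symm (e p)).comp (fderiv ℝ e p) = ContinuousLinearMap.id ℝ Space := by
  have h1 : HasFDerivAt e.symm (fderiv ℝ e.symm (e p)) (e p) :=
    (h.smooth_symm.differentiable (by simp) (e p)).hasFDerivAt
  have h2 := h1.comp p (h.hasFDerivAt p)
  have h3 : (e.symm ∘ e : Space → Space) = id := by ext1 x; simp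
  rw [h3] at h2
  exact h2.unique (hasFDerivAt_id p)

lemma symm (h : IsConj e F G) : IsConj e.symm G F := by
  refine ⟨h.smooth_symm, by simpa using h.smooth, fun q => ?_⟩
  have h1 := h.fderiv_apply (e.symm q)
  have h2 := h.fderiv_symm_comp (e.symm q)
  rw [e.apply_symm_apply] at h1 h2
  rw [← h1]
  exact DFunLike.congr_fun h2 _

lemma hasDerivAt_comp (h : IsConj e F G) {γ : ℝ → Space} {t : ℝ}
    (hγ : HasDerivAt γ (F (γ t)) t) : HasDerivAt (e ∘ γ) (G ((e ∘ γ) t)) t := by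
  have := (h.hasFDerivAt (γ t)).comp_hasDerivAt t hγ
  rwa [h.fderiv_apply] at this

lemma isSolutionOn (h : IsConj e F G) {γ : ℝ → Space} {I : Set ℝ} (hγ : IsSolutionOn F γ I) :
    IsSolutionOn G (e ∘ γ) I :=
  ⟨hγ.isOpen, hγ.ordConnected, hγ.nonempty, fun t ht => h.hasDerivAt_comp (hγ.hasDerivAt t ht)⟩

lemma isTrajectory (h : IsConj e F G) {γ : ℝ → Space} {I : Set ℝ} (hγ : IsTrajectory F γ I) :
    IsTrajectory G (e ∘ γ) I := by
  refine ⟨h.isSolutionOn hγ.toIsSolutionOn, fun δ J hδ hIJ heq => ?_⟩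
  refine hγ.maximal (e.symm ∘ δ) J (h.symm.isSolutionOn hδ) hIJ fun t ht => ?_
  rw [Function.comp_apply, ← heq ht]
  simp

lemma escapesBothWays (h : IsConj e F G) {γ : ℝ → Space} {I : Set ℝ}
    (hγ : EscapesBothWays (e ∘ γ) I) : EscapesBothWays γ I := by
  intro K hK
  obtain ⟨⟨a, ha, ha'⟩, ⟨b, hb, hb'⟩⟩ := hγ (e '' K) (hK.image h.smooth.continuous)
  exact ⟨⟨a, ha, fun t ht h1 h2 => ha' t ht h1 ⟨_, h2, rfl⟩⟩,
    ⟨b, hb, fun t ht h1 h2 => hb' t ht h1 ⟨_, h2, rfl⟩⟩⟩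

lemma isPeriodicOrbit (h : IsConj e F G) {γ : ℝ → Space} {T : ℝ} (hγ : IsPeriodicOrbit F γ T) :
    IsPeriodicOrbit G (e ∘ γ) T := by
  refine ⟨fun t => h.hasDerivAt_comp (hγ.hasDerivAt t), hγ.pos, fun t => ?_, fun s h0 h1 hs => ?_⟩
  · simp [hγ.periodic t]
  · exact hγ.minimal s h0 h1 fun t => e.injective (hs t)

lemma isRegularSurface (h : IsConj e F G) {S : Set Space} (hS : IsRegularSurface S) :
    IsRegularSurface (e '' S) := by
  obtain ⟨hne, hcl, hloc⟩ := hS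
  refine ⟨hne.image _, ?_, ?_⟩
  · rw [e.image_eq_preimage_symm]
    exact hcl.preimage h.smooth_symm.continuous
  rintro _ ⟨p, hp, rfl⟩
  obtain ⟨U, hU, hpU, g, hg, hg', hSU⟩ := hloc p hp
  refine ⟨e.symm ⁻¹' U, hU.preimage h.smooth_symm.continuous, by simpa using hpU, g ∘ e.symm,
    hg.comp h.smooth_symm.contDiffOn (fun _ hq => hq), fun q hq h0 => ?_, ?_⟩
  · apply hg' _ hq
    have hgd : DifferentiableAt ℝ g (e.symm q) :=
      (hg.contDiffAt (hU.mem_nhds hq)).differentiableAt (by simp)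
    rw [fderiv_comp q hgd (h.smooth_symm.differentiable (by simp) q)] at h0
    have h2 := h.fderiv_symm_comp (e.symm q)
    rw [e.apply_symm_apply] at h2
    have h3 := congrArg (fun L => ContinuousLinearMap.comp L (fderiv ℝ e (e.symm q))) h0
    simp only [ContinuousLinearMap.comp_assoc, ContinuousLinearMap.zero_comp] at h3
    rw [h2] at h3
    simpa using h3
  · ext q
    constructor
    · rintro ⟨⟨x, hx, rfl⟩, hxU⟩
      have hxU' : x ∈ U := by simpa using hxU
      have : x ∈ {q ∈ U | g q = 0} := hSU ▸ (⟨hx, hxU'⟩ : x ∈ S ∩ U)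
      exact ⟨hxU, by simpa using this.2⟩
    · rintro ⟨hqU, hq0⟩
      have : e.symm q ∈ S ∩ U := by rw [hSU]; exact ⟨hqU, hq0⟩
      exact ⟨⟨_, this.1, by simp⟩, hqU⟩

lemma isIsochronousPeriodicSurface (h : IsConj e F G) {S : Set Space}
    (hS : IsIsochronousPeriodicSurface F S) : IsIsochronousPeriodicSurface G (e '' S) := by
  obtain ⟨⟨hreg, hper⟩, T, hT⟩ := hS
  refine ⟨⟨h.isRegularSurface hreg, ?_⟩, T, fun γ T' hγ hγS => ?_⟩
  · rintro _ ⟨p, hp, rfl⟩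
    obtain ⟨γ, T, hγ, h0, hγS⟩ := hper p hp
    refine ⟨e ∘ γ, T, h.isPeriodicOrbit hγ, by simp [h0], ?_⟩
    rw [Set.range_comp]
    exact Set.image_mono hγS
  · refine hT (e.symm ∘ γ) T' (h.symm.isPeriodicOrbit hγ) ?_
    rintro _ ⟨t, rfl⟩
    obtain ⟨p, hp, hpt⟩ := hγS ⟨t, rfl⟩
    rw [Function.comp_apply, ← hpt, e.symm_apply_apply]
    exact hp

end IsConj

end NilpotentField

namespace NilpotentField

open Filter Topology

/-! ### Real-variable lemmas -/

/-- Up to sign, the derivative eventually exceeds `m / 2 > 0`, so `f` grows at least linearly. -/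
lemma tendsto_abs_atTop_of_deriv_tendsto {f f' : ℝ → ℝ} {t₀ m : ℝ}
    (hf : ∀ t, t₀ ≤ t → HasDerivAt f (f' t) t) (hlim : Tendsto f' atTop (𝓝 m)) (hm : m ≠ 0) :
    Tendsto (fun t => |f t|) atTop atTop := by
  wlog hpos : 0 < m generalizing f f' m
  · have := this (f := fun t => -f t) (f' := fun t => -f' t) (m := -m)
      (fun t ht => (hf t ht).neg) hlim.neg (neg_ne_zero.2 hm)
      (by rcases lt_or_gt_of_ne hm with h | h <;> [linarith; exact absurd h hpos])
    simpa using this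
  obtain ⟨t₁, ht₁⟩ := (eventually_atTop.1 (hlim.eventually (lt_mem_nhds (half_lt_self hpos))))
  set t₂ := max t₀ t₁
  have hlow : ∀ t, t₂ ≤ t → f t₂ + m / 2 * (t - t₂) ≤ f t := fun t ht => by
    have hd : ∀ s ∈ Set.Icc t₂ t, HasDerivAt f (f' s) s := fun s hs =>
      hf s ((le_max_left _ _).trans hs.1)
    have := (convex_Icc t₂ t).mul_sub_le_image_sub_of_le_deriv (f := f) (C := m / 2)
      (fun s hs => (hd s hs).continuousAt.continuousWithinAt)
      (fun s hs => (hd s (interior_subset hs)).differentiableAt.differentiableWithinAt)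
      (fun s hs => by
        rw [(hd s (interior_subset hs)).deriv]
        exact (ht₁ s ((le_max_right _ _).trans (interior_subset hs).1)).le)
      t₂ (Set.left_mem_Icc.2 ht) t (Set.right_mem_Icc.2 ht) ht
    linarith
  have hlin : Tendsto (fun t => f t₂ + m / 2 * (t - t₂)) atTop atTop :=
    tendsto_atTop_add_const_left _ _
      ((tendsto_atTop_add_const_right _ (-t₂) tendsto_id).const_mul_atTop (half_pos hpos))
  refine tendsto_atTop_mono' _ ?_ hlin
  filter_upwards [eventually_ge_atTop t₂] with t ht
  exact (hlow t ht).trans (le_abs_self _)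

lemma not_tendsto_abs_atTop {f : ℝ → ℝ} {C : ℝ} (h : ∃ᶠ t in atTop, |f t| ≤ C) :
    ¬ Tendsto (fun t => |f t|) atTop atTop := fun ht =>
  h ((ht.eventually_gt_atTop C).mono fun _ hx => not_le.2 hx)

/-- For a monotone function a bound at arbitrarily late times is a bound throughout. -/
lemma exists_tendsto_of_monotoneOn {f : ℝ → ℝ} {t₀ C : ℝ} (hf : MonotoneOn f (Set.Ici t₀))
    (h : ∃ᶠ t in atTop, |f t| ≤ C) : ∃ l, Tendsto f atTop (𝓝 l) := by
  have hmono : Monotone fun t => f (max t t₀) := fun s t hst =>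
    hf (Set.mem_Ici.2 (le_max_right _ _)) (Set.mem_Ici.2 (le_max_right _ _)) (max_le_max hst le_rfl)
  have hbdd : BddAbove (Set.range fun t => f (max t t₀)) := by
    refine ⟨C, ?_⟩
    rintro _ ⟨t, rfl⟩
    obtain ⟨s, hs, hC⟩ := (frequently_atTop.1 h) (max t t₀)
    exact (hf (Set.mem_Ici.2 (le_max_right _ _)) (Set.mem_Ici.2 ((le_max_right _ _).trans hs)) hs).trans
      ((le_abs_self _).trans hC)
  refine ⟨_, (tendsto_atTop_ciSup hmono hbdd).congr' ?_⟩
  filter_upwards [eventually_ge_atTop t₀] with t ht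
  rw [max_eq_left ht]

lemma monotoneOn_Ici_of_hasDerivAt {f f' : ℝ → ℝ} {t₀ : ℝ}
    (hf : ∀ t, t₀ ≤ t → HasDerivAt f (f' t) t) (h : ∀ t, t₀ ≤ t → 0 ≤ f' t) :
    MonotoneOn f (Set.Ici t₀) := by
  refine monotoneOn_of_deriv_nonneg (convex_Ici t₀)
    (fun t ht => (hf t ht).continuousAt.continuousWithinAt)
    (fun t ht => (hf t (interior_subset ht)).differentiableAt.differentiableWithinAt)
    (fun t ht => ?_)
  rw [(hf t (interior_subset ht)).deriv]
  exact h t (interior_subset ht)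

/-! ### The normal form `x' = u`, `u' = v`, `v' = a u² + b` -/

/-- The vector field of the third order equation `x''' = a (x')² + b` in the coordinates
`(x, u, v) = (x, x', x'')`. -/
def normalField (a b : ℝ) (p : Space) : Space := ![p 1, p 2, a * p 1 ^ 2 + b]

lemma contDiff_normalField (a b : ℝ) {n : WithTop ℕ∞} : ContDiff ℝ n (normalField a b) := by
  rw [contDiff_pi]
  intro i
  fin_cases i <;> simp [normalField] <;> fun_prop

section Solutions

variable {a b : ℝ} {γ : ℝ → Space} {I : Set ℝ}

lemma hasDerivAt_normalField_iff {t : ℝ} : HasDerivAt γ (normalField a b (γ t)) t ↔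
    HasDerivAt (fun s => γ s 0) (γ t 1) t ∧ HasDerivAt (fun s => γ s 1) (γ t 2) t ∧
      HasDerivAt (fun s => γ s 2) (a * γ t 1 ^ 2 + b) t := by
  rw [hasDerivAt_pi, Fin.forall_fin_succ, Fin.forall_fin_succ, Fin.forall_fin_one]
  simp [normalField]

lemma eq_of_hasDerivAt_zero {f : ℝ → ℝ} {I : Set ℝ} (hI : IsOpen I)
    (hc : I.OrdConnected) (hf : ∀ t ∈ I, HasDerivAt f 0 t) {s t : ℝ} (hs : s ∈ I) (ht : t ∈ I) :
    f s = f t :=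
  hI.is_const_of_deriv_eq_zero hc.isPreconnected
    (fun r hr => (hf r hr).differentiableAt.differentiableWithinAt)
    (fun r hr => (hf r hr).deriv) hs ht

/-- The first integral `v² - (2a/3) u³ - 2 b u`. -/
lemma IsSolutionOn.energy_eq (h : IsSolutionOn (normalField a b) γ I) {s t : ℝ} (hs : s ∈ I)
    (ht : t ∈ I) : γ s 2 ^ 2 - 2 * a / 3 * γ s 1 ^ 3 - 2 * b * γ s 1 =
      γ t 2 ^ 2 - 2 * a / 3 * γ t 1 ^ 3 - 2 * b * γ t 1 := by
  refine eq_of_hasDerivAt_zero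
    (f := fun t => γ t 2 ^ 2 - 2 * a / 3 * γ t 1 ^ 3 - 2 * b * γ t 1)
    h.isOpen h.ordConnected (fun r hr => ?_) hs ht
  obtain ⟨-, h1, h2⟩ := hasDerivAt_normalField_iff.1 (h.hasDerivAt r hr)
  have := ((h2.pow 2).sub ((h1.pow 3).const_mul (2 * a / 3))).sub (h1.const_mul (2 * b))
  refine this.congr_deriv ?_
  push_cast
  ring

lemma ReturnsForward.frequently (hr : ReturnsForward γ I) {t₀ : ℝ} (ht₀ : Set.Ici t₀ ⊆ I) :
    ∃ C, ∀ i, ∃ᶠ t in atTop, |γ t i| ≤ C := by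
  obtain ⟨K, hK, hret⟩ := hr
  obtain ⟨C, hC⟩ := hK.isBounded.exists_norm_le
  refine ⟨C, fun i => frequently_atTop.2 fun s => ?_⟩
  obtain ⟨t, -, hst, htK⟩ := hret (max s t₀) (ht₀ (Set.mem_Ici.2 (le_max_right _ _)))
  exact ⟨t, (le_max_left _ _).trans hst, (norm_le_pi_norm (γ t) i).trans (hC _ htK)⟩

/-- A returning solution along which `u' = v` has a constant sign tends to `u = v = 0`, and this is
possible for `b = 0` only. -/
lemma IsSolutionOn.tendsto_of_sign (h : IsSolutionOn (normalField a b) γ I)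
    (hr : ReturnsForward γ I) {t₀ : ℝ} (ht₀ : Set.Ici t₀ ⊆ I)
    (hsign : (∀ t, t₀ ≤ t → 0 ≤ γ t 2) ∨ (∀ t, t₀ ≤ t → γ t 2 ≤ 0)) :
    b = 0 ∧ Tendsto (fun t => γ t 1) atTop (𝓝 0) ∧ Tendsto (fun t => γ t 2) atTop (𝓝 0) := by
  obtain ⟨C, hC⟩ := hr.frequently ht₀
  have hd := fun t (ht : t₀ ≤ t) => hasDerivAt_normalField_iff.1 (h.hasDerivAt t (ht₀ ht))
  obtain ⟨l, hl⟩ : ∃ l, Tendsto (fun t => γ t 1) atTop (𝓝 l) := by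
    rcases hsign with hs | hs
    · exact exists_tendsto_of_monotoneOn
        (monotoneOn_Ici_of_hasDerivAt (fun t ht => (hd t ht).2.1) hs) (hC 1)
    · obtain ⟨l, hl⟩ := exists_tendsto_of_monotoneOn (f := fun t => -γ t 1) (C := C)
        (monotoneOn_Ici_of_hasDerivAt (fun t ht => (hd t ht).2.1.neg)
          (fun t ht => neg_nonneg.2 (hs t ht))) (by simpa using hC 1)
      exact ⟨-l, by simpa using hl.neg⟩
  -- The first integral expresses `v²` through `u`; the sign of `v` then selects the square root.
  have hsq : ∃ L, Tendsto (fun t => γ t 2 ^ 2) atTop (𝓝 L) := by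
    set E := γ t₀ 2 ^ 2 - 2 * a / 3 * γ t₀ 1 ^ 3 - 2 * b * γ t₀ 1
    refine ⟨2 * a / 3 * l ^ 3 + 2 * b * l + E,
      ((((hl.pow 3).const_mul (2 * a / 3)).add (hl.const_mul (2 * b))).add_const E).congr' ?_⟩
    filter_upwards [eventually_ge_atTop t₀] with t ht
    have := h.energy_eq (ht₀ ht) (ht₀ Set.self_mem_Ici)
    simp only [E]
    linarith
  obtain ⟨L, hL⟩ := hsq
  have hv : ∃ m, Tendsto (fun t => γ t 2) atTop (𝓝 m) := by
    have hs := (Real.continuous_sqrt.tendsto L).comp hL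
    rcases hsign with hs' | hs'
    · refine ⟨√L, hs.congr' ?_⟩
      filter_upwards [eventually_ge_atTop t₀] with t ht
      exact Real.sqrt_sq (hs' t ht)
    · refine ⟨-√L, hs.neg.congr' ?_⟩
      filter_upwards [eventually_ge_atTop t₀] with t ht
      simp only [Function.comp_apply]
      rw [Real.sqrt_sq_eq_abs, abs_of_nonpos (hs' t ht), neg_neg]
  obtain ⟨m, hm⟩ := hv
  -- Each of `u`, `x`, `v` is bounded at late times, so the limits of their derivatives `v`, `u`, `a
  -- u² + b` vanish in turn.
  have hm0 : m = 0 := by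
    by_contra hne
    exact not_tendsto_abs_atTop (hC 1)
      (tendsto_abs_atTop_of_deriv_tendsto (fun t ht => (hd t ht).2.1) hm hne)
  have hl0 : l = 0 := by
    by_contra hne
    exact not_tendsto_abs_atTop (hC 0)
      (tendsto_abs_atTop_of_deriv_tendsto (fun t ht => (hd t ht).1) hl hne)
  have hb : a * l ^ 2 + b = 0 := by
    by_contra hne
    exact not_tendsto_abs_atTop (hC 2) (tendsto_abs_atTop_of_deriv_tendsto
      (fun t ht => (hd t ht).2.2) (((hl.pow 2).const_mul a).add_const b) hne)
  subst hm0 hl0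
  exact ⟨by simpa using hb, hl, hm⟩

/-- If `v' = a u² + b` has a constant sign, then a returning trajectory tends to `u = v = 0`. -/
lemma IsTrajectory.tendsto_of_forcing_sign (h : IsTrajectory (normalField a b) γ I)
    (hr : ReturnsForward γ I)
    (hsign : (∀ s : ℝ, 0 ≤ a * s ^ 2 + b) ∨ (∀ s : ℝ, a * s ^ 2 + b ≤ 0)) :
    b = 0 ∧ Tendsto (fun t => γ t 1) atTop (𝓝 0) ∧ Tendsto (fun t => γ t 2) atTop (𝓝 0) := by
  obtain ⟨t₀, ht₀⟩ := h.nonempty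
  have hI := h.Ici_subset (contDiff_normalField a b) hr ht₀
  have hd := fun t (ht : t₀ ≤ t) => hasDerivAt_normalField_iff.1 (h.hasDerivAt t (hI ht))
  suffices ∃ t₁, t₀ ≤ t₁ ∧ ((∀ t, t₁ ≤ t → 0 ≤ γ t 2) ∨ (∀ t, t₁ ≤ t → γ t 2 ≤ 0)) by
    obtain ⟨t₁, h01, hs⟩ := this
    exact h.toIsSolutionOn.tendsto_of_sign hr ((Set.Ici_subset_Ici.2 h01).trans hI) hs
  rcases hsign with hs | hs
  · have hmono := monotoneOn_Ici_of_hasDerivAt (fun t ht => (hd t ht).2.2) (fun t _ => hs _)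
    -- A monotone `v` has a constant sign after its first nonnegative value, or is always negative.
    by_cases hex : ∃ t₁, t₀ ≤ t₁ ∧ 0 ≤ γ t₁ 2
    · obtain ⟨t₁, h1, h2⟩ := hex
      exact ⟨t₁, h1, Or.inl fun t ht => h2.trans (hmono h1 (h1.trans ht) ht)⟩
    · push Not at hex
      exact ⟨t₀, le_rfl, Or.inr fun t ht => (hex t ht).le⟩
  · have hmono := monotoneOn_Ici_of_hasDerivAt (fun t ht => (hd t ht).2.2.neg)
      (fun t _ => neg_nonneg.2 (hs _))
    by_cases hex : ∃ t₁, t₀ ≤ t₁ ∧ γ t₁ 2 ≤ 0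
    · obtain ⟨t₁, h1, h2⟩ := hex
      exact ⟨t₁, h1, Or.inr fun t ht => (neg_le_neg_iff.1 (hmono h1 (h1.trans ht) ht)).trans h2⟩
    · push Not at hex
      exact ⟨t₀, le_rfl, Or.inl fun t ht => (hex t ht).le⟩

/-! ### Time reversal -/

/-- The reversing symmetry `(x, u, v) ↦ (-x, u, -v)`. -/
def reflect (p : Space) : Space := ![-p 0, p 1, -p 2]

lemma reflect_reflect (p : Space) : reflect (reflect p) = p := by
  ext i; fin_cases i <;> simp [reflect]

lemma continuous_reflect : Continuous reflect := by
  refine continuous_pi fun i => ?_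
  fin_cases i <;> simp [reflect] <;> fun_prop

lemma IsSolutionOn.reverse (h : IsSolutionOn (normalField a b) γ I) :
    IsSolutionOn (normalField a b) (fun t => reflect (γ (-t))) (-I) := by
  refine ⟨h.isOpen.neg, ⟨fun x hx y hy z hz => ?_⟩, h.nonempty.neg, fun t ht => ?_⟩
  · exact h.ordConnected.out hy hx ⟨neg_le_neg hz.2, neg_le_neg hz.1⟩
  · obtain ⟨h0, h1, h2⟩ := hasDerivAt_normalField_iff.1 (h.hasDerivAt (-t) ht)
    rw [hasDerivAt_normalField_iff]
    have hn := hasDerivAt_neg t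
    refine ⟨?_, ?_, ?_⟩
    · exact (h0.scomp t hn).neg.congr_deriv (by simp [reflect])
    · exact (h1.scomp t hn).congr_deriv (by simp [reflect])
    · exact (h2.scomp t hn).neg.congr_deriv (by simp [reflect])

lemma IsTrajectory.reverse (h : IsTrajectory (normalField a b) γ I) :
    IsTrajectory (normalField a b) (fun t => reflect (γ (-t))) (-I) := by
  refine ⟨h.toIsSolutionOn.reverse, fun δ J hδ hIJ heq => ?_⟩
  rw [← Set.neg_subset_neg, neg_neg]
  refine h.maximal _ (-J) hδ.reverse ?_ fun t ht => ?_
  · rw [← Set.neg_subset_neg, neg_neg]; exact hIJ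
  · have := heq (show -t ∈ -I by simpa using ht)
    simp only [neg_neg] at this
    change γ t = reflect (δ (-t))
    rw [← this, reflect_reflect]

/-- Leaving `K` in backward time amounts to the reversed curve leaving `reflect '' K` in forward
time. -/
lemma escapesBothWays_of_not_returnsForward (h1 : ¬ ReturnsForward γ I)
    (h2 : ¬ ReturnsForward (fun t => reflect (γ (-t))) (-I)) : EscapesBothWays γ I := by
  intro K hK
  simp only [ReturnsForward, not_exists, not_and, not_forall] at h1 h2
  obtain ⟨t₁, ht₁, h1⟩ := h1 K hK
  obtain ⟨t₂, ht₂, h2⟩ := h2 (reflect '' K) (hK.image continuous_reflect)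
  refine ⟨⟨t₁, ht₁, fun t ht hle hm => h1 t ht hle hm⟩,
    ⟨-t₂, ht₂, fun t ht hle hm => h2 (-t) (by simpa using ht) (by linarith) ?_⟩⟩
  simpa using Set.mem_image_of_mem reflect hm

/-! ### Returning solutions with `a = 3/2`, `b < 0` lie on ovals -/

/-- The cylinder over the oval of the cubic curve `v² = (r² - (u + n)²) (2 n - u)`. -/
def ovalCylinder (n r : ℝ) : Set Space :=
  {p | p 2 ^ 2 = (r ^ 2 - (p 1 + n) ^ 2) * (2 * n - p 1) ∧ p 1 < 2 * n}

/-- Equilibria of the `(u, v)`-system lift to uniform motion in `x`; by uniqueness the solution is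
that motion. -/
lemma IsSolutionOn.eq_zero_of_equilibrium (h : IsSolutionOn (normalField a b) γ I) {s t : ℝ}
    (hs : s ∈ I) (ht : t ∈ I) (h2 : γ s 2 = 0) (h1 : a * γ s 1 ^ 2 + b = 0) : γ t 2 = 0 := by
  have hc : IsSolutionOn (normalField a b) (fun t => ![γ s 0 + γ s 1 * (t - s), γ s 1, 0]) I := by
    refine ⟨h.isOpen, h.ordConnected, h.nonempty, fun t _ => ?_⟩
    rw [hasDerivAt_normalField_iff]
    refine ⟨?_, ?_, ?_⟩
    · simpa using ((((hasDerivAt_id t).sub_const s).const_mul (γ s 1)).const_add (γ s 0))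
    · simpa using hasDerivAt_const t (γ s 1)
    · simpa [h1] using hasDerivAt_const t (0 : ℝ)
  have := IsSolutionOn.eqOn (contDiff_normalField a b) h hc hs
    (by ext i; fin_cases i <;> simp [h2]) ht
  simpa using congrFun this 2

/-- The maximum may sit at an endpoint, where Fermat's theorem is silent; there the hypothesis on
`f'` takes over. -/
lemma exists_isMaxOn_Icc_deriv_eq_zero {f f' : ℝ → ℝ} {s t : ℝ} (hst : s ≤ t)
    (hf : ∀ r ∈ Set.Icc s t, HasDerivAt f (f' r) r) (hs : f' s = 0) (ht : f' t = 0) :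
    ∃ r ∈ Set.Icc s t, f' r = 0 ∧ ∀ q ∈ Set.Icc s t, f q ≤ f r := by
  obtain ⟨r, hr, hmax⟩ := isCompact_Icc.exists_isMaxOn (Set.nonempty_Icc.2 hst)
    (fun r hr => (hf r hr).continuousAt.continuousWithinAt)
  refine ⟨r, hr, ?_, hmax⟩
  rcases eq_or_lt_of_le hr.1 with h1 | h1
  · rwa [← h1]
  rcases eq_or_lt_of_le hr.2 with h2 | h2
  · rwa [h2]
  exact (hmax.isLocalMax (Icc_mem_nhds h1 h2)).hasDerivAt_eq_zero (hf r hr)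

/-- Between two zeros of `v` the extreme values `m < M` of `u` are attained with `v = 0`, so they
are roots of the cubic in `v² = u³ + 2 b u + const`, whose third root is `-m - M`. Since `v² ≥ 0` on
`[m, M]` and `M` is not an equilibrium, the third root lies beyond `M`. -/
lemma IsSolutionOn.exists_oval (h : IsSolutionOn (normalField (3 / 2) b) γ I) {s q t : ℝ}
    (hs : s ∈ I) (ht : t ∈ I) (hsq : s < q) (hqt : q < t) (h0 : γ s 2 = 0) (h1 : γ t 2 = 0)
    (hq : γ q 2 ≠ 0) :
    ∃ n r : ℝ, 0 < r ∧ r < 3 * n ∧ 3 * n ^ 2 + r ^ 2 = -2 * b ∧ γ s ∈ ovalCylinder n r := by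
  have hI : Set.Icc s t ⊆ I := h.ordConnected.out hs ht
  have hst : s ≤ t := (hsq.trans hqt).le
  have hqm : q ∈ Set.Icc s t := ⟨hsq.le, hqt.le⟩
  have hsm : s ∈ Set.Icc s t := ⟨le_rfl, hst⟩
  have hd := fun r (hr : r ∈ Set.Icc s t) =>
    (hasDerivAt_normalField_iff.1 (h.hasDerivAt r (hI hr))).2.1
  obtain ⟨tM, htM, hvM, hM⟩ := exists_isMaxOn_Icc_deriv_eq_zero hst hd h0 h1
  obtain ⟨tm, htm, hvm, hm⟩ := exists_isMaxOn_Icc_deriv_eq_zero (f := fun r => -γ r 1)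
    (f' := fun r => -γ r 2) hst (fun r hr => (hd r hr).neg) (by simpa using h0) (by simpa using h1)
  simp only [neg_eq_zero, neg_le_neg_iff] at hvm hm
  have hE := fun r (hr : r ∈ Set.Icc s t) => h.energy_eq (hI hr) (hI htM)
  have hcont : ContinuousOn (fun r => γ r 1) (Set.Icc s t) := fun r hr =>
    (hd r hr).continuousAt.continuousWithinAt
  have hmM := hE tm htm
  rw [hvm, hvM] at hmM
  rw [hvM] at hE
  set M := γ tM 1
  set m := γ tm 1
  have hlt : m < M := by
    refine lt_of_le_of_ne (hM tm htm) fun heq => hq ?_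
    have hconst : ∀ r ∈ Set.Icc s t, γ r 1 = M := fun r hr =>
      le_antisymm (hM r hr) (heq ▸ hm r hr)
    have h2 : HasDerivAt (fun r => γ r 1) 0 q := (hasDerivAt_const q M).congr_of_eventuallyEq (by
      filter_upwards [Icc_mem_nhds hsq hqt] with r hr using hconst r hr)
    exact (hd q hqm).unique h2
  -- Equality of the energies at `m` and `M`, divided by `M - m`.
  have hb : m ^ 2 + m * M + M ^ 2 = -2 * b :=
    mul_left_cancel₀ (sub_ne_zero.2 hlt.ne') (by linear_combination hmM)
  have hcurve : ∀ r ∈ Set.Icc s t, γ r 2 ^ 2 = (γ r 1 - m) * (γ r 1 - M) * (γ r 1 + m + M) :=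
    fun r hr => by linear_combination hE r hr + (γ r 1 - M) * hb
  -- If the third root equals `M`, then `M` is a double root, hence an equilibrium; if it is
  -- smaller, the cubic is negative just below `M`, at a value that `u` takes.
  have hlast : m + 2 * M < 0 := by
    by_contra hge
    rcases eq_or_lt_of_le (not_lt.1 hge) with h3 | h3
    · exact hq (h.eq_zero_of_equilibrium (hI htM) (hI hqm) hvM
        (by linear_combination (1 / 2) * hb - (1 / 2) * (M - m) * h3))
    · obtain ⟨w, hw1, hw2⟩ := exists_between (show max m (-m - M) < M from
        max_lt hlt (by linarith))
      have hw3 : m < w := (le_max_left _ _).trans_lt hw1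
      have hw4 : -m - M < w := (le_max_right _ _).trans_lt hw1
      obtain ⟨r, hr, hrw⟩ := isPreconnected_Icc.intermediate_value htm htM hcont
        (show w ∈ Set.Icc m M from ⟨hw3.le, hw2.le⟩)
      have h5 := hcurve r hr
      simp only at hrw
      rw [hrw] at h5
      have h6 : (w - m) * (M - w) * (w + m + M) > 0 :=
        mul_pos (mul_pos (by linarith) (by linarith)) (by linarith)
      nlinarith [sq_nonneg (γ r 2)]
  -- The oval has centre `u = -n` and half-width `r`; the third root is `2 n`.
  refine ⟨-(m + M) / 2, (M - m) / 2, by linarith, by linarith, by linear_combination hb, ?_, ?_⟩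
  · linear_combination hcurve s hsm
  · have := hM s hsm
    linarith

/-- If `b < 0`, a returning trajectory meets an oval cylinder. -/
lemma IsTrajectory.exists_oval (h : IsTrajectory (normalField (3 / 2) b) γ I) (hb : b < 0)
    (hr : ReturnsForward γ I) :
    ∃ n r : ℝ, 0 < r ∧ r < 3 * n ∧ 3 * n ^ 2 + r ^ 2 = -2 * b ∧
      ∃ s ∈ I, γ s ∈ ovalCylinder n r := by
  obtain ⟨t₀, ht₀⟩ := h.nonempty
  have hI := h.Ici_subset (contDiff_normalField _ b) hr ht₀
  -- If `v` eventually kept one sign, `b` would be `0`. So `v` is negative, positive and negative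
  -- again, which gives two zeros enclosing a point with `v ≠ 0`.
  have hkey : ∀ t₁, t₀ ≤ t₁ → (∃ t, t₁ ≤ t ∧ γ t 2 < 0) ∧ (∃ t, t₁ ≤ t ∧ 0 < γ t 2) := by
    intro t₁ h01
    have hI₁ := (Set.Ici_subset_Ici.2 h01).trans hI
    constructor
    · by_contra hcon
      push Not at hcon
      exact hb.ne (h.toIsSolutionOn.tendsto_of_sign hr hI₁ (Or.inl hcon)).1
    · by_contra hcon
      push Not at hcon
      exact hb.ne (h.toIsSolutionOn.tendsto_of_sign hr hI₁ (Or.inr hcon)).1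
  obtain ⟨s₁, h1, hs₁⟩ := (hkey t₀ le_rfl).1
  obtain ⟨s₂, h2, hs₂⟩ := (hkey s₁ h1).2
  obtain ⟨s₃, h3, hs₃⟩ := (hkey s₂ (h1.trans h2)).1
  have hcont : ContinuousOn (fun r => γ r 2) (Set.Ici t₀) := fun r hr =>
    (hasDerivAt_normalField_iff.1 (h.hasDerivAt r (hI hr))).2.2.continuousAt.continuousWithinAt
  obtain ⟨p, hp, hp0⟩ := intermediate_value_Icc h2
    (hcont.mono fun r hr => h1.trans hr.1) (show (0 : ℝ) ∈ _ from ⟨hs₁.le, hs₂.le⟩)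
  obtain ⟨q, hq, hq0⟩ := intermediate_value_Icc' h3
    (hcont.mono fun r hr => (h1.trans h2).trans hr.1) (show (0 : ℝ) ∈ _ from ⟨hs₃.le, hs₂.le⟩)
  simp only at hp0 hq0
  have hps : p < s₂ := lt_of_le_of_ne hp.2 fun e => by rw [e] at hp0; linarith
  have hsq : s₂ < q := lt_of_le_of_ne hq.1 fun e => by rw [← e] at hq0; linarith
  have hpI : p ∈ I := hI (h1.trans hp.1)
  obtain ⟨n, r, H1, H2, H3, H4⟩ := h.toIsSolutionOn.exists_oval hpI
    (hI ((h1.trans h2).trans hq.1)) hps hsq hp0 hq0 hs₂.ne'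
  exact ⟨n, r, H1, H2, H3, p, hpI, H4⟩

end Solutions

end NilpotentField

namespace NilpotentField

open Filter Topology intervalIntegral

/-! ### The drift integral -/

/-- Up to a negative factor, the displacement of `x` over one turn of an oval of shape `k = r / n`. -/
noncomputable def drift (k : ℝ) : ℝ :=
  ∫ θ in (0 : ℝ)..2 * Real.pi, (1 + k * Real.cos θ) / √(3 + k * Real.cos θ)

lemma three_add_mul_cos_pos {k : ℝ} (h0 : 0 ≤ k) (h3 : k < 3) (θ : ℝ) : 0 < 3 + k * Real.cos θ := by
  nlinarith [Real.neg_one_le_cos θ]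

lemma continuous_drift_integrand {k : ℝ} (h0 : 0 ≤ k) (h3 : k < 3) :
    Continuous fun θ => (1 + k * Real.cos θ) / √(3 + k * Real.cos θ) :=
  Continuous.div (by fun_prop) (by fun_prop)
    fun θ => (Real.sqrt_pos.2 (three_add_mul_cos_pos h0 h3 θ)).ne'

/-- With `w = √(3 ± s)` each term is `w - 2 / w`, so the sum depends only on the sum `P` and the
product of the two roots, and the product is `(P ^ 2 - 6) / 2`. The result increases with `P`, which
decreases with `s²`. -/
lemma drift_integrand_symm_eq {s : ℝ} (hs : s ^ 2 < 9) :
    ∃ P, 0 < P ∧ P ^ 2 = 6 + 2 * √(9 - s ^ 2) ∧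
      (1 + s) / √(3 + s) + (1 - s) / √(3 - s) = P - 4 * P / (P ^ 2 - 6) := by
  have h1 : 0 < 3 + s := by nlinarith
  have h2 : 0 < 3 - s := by nlinarith
  have hp := Real.sqrt_pos.2 h1
  have hq := Real.sqrt_pos.2 h2
  have hp2 := Real.sq_sqrt h1.le
  have hq2 := Real.sq_sqrt h2.le
  have hpq : √(9 - s ^ 2) = √(3 + s) * √(3 - s) := by
    rw [← Real.sqrt_mul h1.le]; congr 1; ring
  refine ⟨√(3 + s) + √(3 - s), by positivity, by rw [hpq]; linear_combination hp2 + hq2, ?_⟩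
  have h6 : (√(3 + s) + √(3 - s)) ^ 2 - 6 = 2 * (√(3 + s) * √(3 - s)) := by
    linear_combination hp2 + hq2
  rw [h6]
  have e1 : 1 + s = √(3 + s) ^ 2 - 2 := by rw [hp2]; ring
  have e2 : 1 - s = √(3 - s) ^ 2 - 2 := by rw [hq2]; ring
  rw [e1, e2]
  generalize √(3 + s) = p at *
  generalize √(3 - s) = q at *
  field_simp
  ring

lemma drift_integrand_symm_lt {s t : ℝ} (hst : s ^ 2 < t ^ 2) (ht : t ^ 2 < 9) :
    (1 + t) / √(3 + t) + (1 - t) / √(3 - t) < (1 + s) / √(3 + s) + (1 - s) / √(3 - s) := by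
  obtain ⟨P, hP, hP2, hPe⟩ := drift_integrand_symm_eq ht
  obtain ⟨Q, hQ, hQ2, hQe⟩ := drift_integrand_symm_eq (hst.trans ht)
  rw [hPe, hQe]
  have hlt : √(9 - t ^ 2) < √(9 - s ^ 2) := Real.sqrt_lt_sqrt (by linarith) (by linarith)
  have hpos : 0 < √(9 - t ^ 2) := Real.sqrt_pos.2 (by linarith)
  have hPQ : P < Q := lt_of_pow_lt_pow_left₀ 2 hQ.le (by linarith)
  have h1 : 0 < P ^ 2 - 6 := by linarith
  have h2 : 0 < Q ^ 2 - 6 := by linarith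
  have h3 : 4 * Q / (Q ^ 2 - 6) < 4 * P / (P ^ 2 - 6) := by
    rw [div_lt_div_iff₀ h2 h1]
    have : 0 < (Q - P) * (P * Q + 6) := mul_pos (by linarith) (by positivity)
    nlinarith
  linarith

/-- Pairing `θ` with `θ + π` replaces the integrand by one that is pointwise monotone in `k`, which
the original is not. -/
lemma two_mul_drift {k : ℝ} (h0 : 0 ≤ k) (h3 : k < 3) :
    2 * drift k = ∫ θ in (0 : ℝ)..2 * Real.pi, ((1 + k * Real.cos θ) / √(3 + k * Real.cos θ) +
      (1 - k * Real.cos θ) / √(3 - k * Real.cos θ)) := by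
  have hc := continuous_drift_integrand h0 h3
  have hper : Function.Periodic (fun θ => (1 + k * Real.cos θ) / √(3 + k * Real.cos θ))
      (2 * Real.pi) := fun θ => by simp
  have hshift : ∫ θ in (0 : ℝ)..2 * Real.pi, (1 - k * Real.cos θ) / √(3 - k * Real.cos θ) =
      drift k := by
    have h1 : ∀ θ, (1 - k * Real.cos θ) / √(3 - k * Real.cos θ) =
        (fun θ => (1 + k * Real.cos θ) / √(3 + k * Real.cos θ)) (θ + Real.pi) := fun θ => by
      simp [sub_eq_add_neg]
    simp_rw [h1]
    rw [intervalIntegral.integral_comp_add_right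
      (f := fun θ => (1 + k * Real.cos θ) / √(3 + k * Real.cos θ)), drift]
    have := hper.intervalIntegral_add_eq Real.pi 0
    rw [zero_add] at this
    rw [zero_add, add_comm (2 * Real.pi), this]
  have hc' : Continuous fun θ => (1 - k * Real.cos θ) / √(3 - k * Real.cos θ) := by
    have := hc.comp (continuous_add_const Real.pi)
    simpa [Function.comp_def, sub_eq_add_neg] using this
  rw [intervalIntegral.integral_add (hc.intervalIntegrable _ _) (hc'.intervalIntegrable _ _),
    hshift, drift]
  ring

lemma drift_strictAntiOn : StrictAntiOn drift (Set.Ico 0 3) := by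
  rintro k ⟨hk0, hk3⟩ l ⟨hl0, hl3⟩ hkl
  have hcont : ∀ m, 0 ≤ m → m < 3 → Continuous fun θ : ℝ =>
      (1 + m * Real.cos θ) / √(3 + m * Real.cos θ) +
      (1 - m * Real.cos θ) / √(3 - m * Real.cos θ) := fun m h0 h3 => by
    have hc := continuous_drift_integrand h0 h3
    have := hc.comp (continuous_add_const Real.pi)
    refine hc.add ?_
    simpa [Function.comp_def, sub_eq_add_neg] using this
  have hsq : k ^ 2 < l ^ 2 := by nlinarith
  have h9 : l ^ 2 < 9 := by nlinarith
  suffices 2 * drift l < 2 * drift k by linarith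
  rw [two_mul_drift hl0 hl3, two_mul_drift hk0 hk3]
  refine integral_lt_integral_of_continuousOn_of_le_of_exists_lt (by positivity)
    (hcont l hl0 hl3).continuousOn (hcont k hk0 hk3).continuousOn (fun θ _ => ?_)
    ⟨0, ⟨le_rfl, by positivity⟩, ?_⟩
  · have hc1 : Real.cos θ ^ 2 ≤ 1 := Real.cos_sq_le_one θ
    rcases eq_or_ne (Real.cos θ) 0 with h | h
    · simp [h]
    · have : 0 < Real.cos θ ^ 2 := by positivity
      refine (drift_integrand_symm_lt ?_ ?_).le <;> rw [mul_pow]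
      · rw [mul_pow]; exact mul_lt_mul_of_pos_right hsq this
      · nlinarith
  · rw [Real.cos_zero, mul_one, mul_one]
    exact drift_integrand_symm_lt hsq h9

lemma drift_continuousOn {l : ℝ} (hl : l < 3) : ContinuousOn drift (Set.Icc 0 l) := by
  have hpos : ∀ k : ℝ, 0 ≤ max 0 (min k l) ∧ max 0 (min k l) < 3 := fun k =>
    ⟨le_max_left _ _, max_lt (by norm_num) ((min_le_right _ _).trans_lt hl)⟩
  -- Clamping `k` to `[0, l]` keeps the radicand positive for every real `k`, so the parametric
  -- integral is globally continuous.
  have h : Continuous fun k => drift (max 0 (min k l)) := by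
    refine continuous_parametric_intervalIntegral_of_continuous' ?_ _ _
    refine Continuous.div (by fun_prop) (by fun_prop) ?_
    rintro ⟨k, θ⟩
    exact (Real.sqrt_pos.2 (three_add_mul_cos_pos (hpos k).1 (hpos k).2 θ)).ne'
  refine h.continuousOn.congr fun k hk => ?_
  simp only
  rw [min_eq_left hk.2, max_eq_right hk.1]

lemma drift_zero_pos : 0 < drift 0 := by
  simp only [drift, zero_mul, add_zero, intervalIntegral.integral_const, smul_eq_mul]
  have : 0 < √3 := Real.sqrt_pos.2 (by norm_num)
  have := Real.pi_pos
  rw [sub_zero]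
  positivity

lemma integral_inv_linear {δ : ℝ} (hδ : 0 < δ) :
    ∫ θ in (0 : ℝ)..Real.pi, 2 / (δ + 5 / 4 * θ) =
      8 / 5 * (Real.log (δ + 5 / 4 * Real.pi) - Real.log δ) := by
  have hpi := Real.pi_pos
  have hpos : ∀ θ ∈ Set.uIcc 0 Real.pi, 0 < δ + 5 / 4 * θ := fun θ hθ => by
    rw [Set.uIcc_of_le hpi.le] at hθ
    linarith [hθ.1]
  have hd : ∀ θ ∈ Set.uIcc 0 Real.pi,
      HasDerivAt (fun θ => 8 / 5 * Real.log (δ + 5 / 4 * θ)) (2 / (δ + 5 / 4 * θ)) θ := by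
    intro θ hθ
    have h1 : HasDerivAt (fun θ => δ + 5 / 4 * θ) (5 / 4) θ := by
      simpa using ((hasDerivAt_id θ).const_mul (5 / 4)).const_add δ
    refine ((h1.log (hpos θ hθ).ne').const_mul (8 / 5)).congr_deriv ?_
    ring
  rw [integral_eq_sub_of_hasDerivAt hd]
  · simp; ring
  · refine ContinuousOn.intervalIntegrable ?_
    exact ContinuousOn.div (by fun_prop) (by fun_prop) fun θ hθ => (hpos θ hθ).ne'

/-- As `k → 3` the term `-2 / √(3 + k cos θ)` becomes nearly singular at `θ = π`, and its integral
diverges logarithmically to `-∞`. Near `π` the root is at most `δ + (5/4) |θ - π|` with `δ² = 3 -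
k`, so half of the drift is at most `π √6 + (8/5) log δ`. The choice `δ = exp (-5)` makes the
logarithmic term `-8`, and `π √6 < 8`. -/
lemma drift_neg : drift (3 - Real.exp (-10)) < 0 := by
  set ε := Real.exp (-10) with hε
  set δ := Real.exp (-5) with hδ
  have hεδ : ε = δ ^ 2 := by rw [hε, hδ, ← Real.exp_nat_mul]; norm_num
  have hδ0 : 0 < δ := Real.exp_pos _
  have hδ1 : δ < 1 := by rw [hδ, Real.exp_lt_one_iff]; norm_num
  have hε0 : 0 < ε := Real.exp_pos _
  have hε1 : ε < 1 := by nlinarith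
  set k := 3 - ε with hk
  have hk0 : 0 ≤ k := by linarith
  have hk3 : k < 3 := by linarith
  have hpi := Real.pi_pos
  have hc := continuous_drift_integrand hk0 hk3
  set f : ℝ → ℝ := fun θ => (1 + k * Real.cos θ) / √(3 + k * Real.cos θ) with hf
  have hsymm : ∫ θ in Real.pi..2 * Real.pi, f θ = ∫ θ in (0 : ℝ)..Real.pi, f θ := by
    have h1 : ∀ θ, f θ = f (2 * Real.pi - θ) := fun θ => by
      simp [hf, Real.cos_two_pi_sub]
    rw [intervalIntegral.integral_congr (g := fun θ => f (2 * Real.pi - θ)) fun θ _ => h1 θ,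
      intervalIntegral.integral_comp_sub_left]
    congr 1 <;> ring
  have hrefl : ∫ θ in (0 : ℝ)..Real.pi, f θ = ∫ θ in (0 : ℝ)..Real.pi, f (Real.pi - θ) := by
    rw [intervalIntegral.integral_comp_sub_left]; simp
  have hsplit : drift k = 2 * ∫ θ in (0 : ℝ)..Real.pi, f (Real.pi - θ) := by
    rw [drift, ← intervalIntegral.integral_add_adjacent_intervals
      (hc.intervalIntegrable 0 Real.pi) (hc.intervalIntegrable Real.pi (2 * Real.pi))]
    change (∫ θ in (0 : ℝ)..Real.pi, f θ) + (∫ θ in Real.pi..2 * Real.pi, f θ) = _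
    rw [hsymm, hrefl]; ring
  have hcmp : ∫ θ in (0 : ℝ)..Real.pi, f (Real.pi - θ) ≤
      ∫ θ in (0 : ℝ)..Real.pi, (√6 - 2 / (δ + 5 / 4 * θ)) := by
    refine intervalIntegral.integral_mono_on hpi.le
      ((hc.comp (continuous_const.sub continuous_id)).intervalIntegrable _ _) ?_ fun θ hθ => ?_
    · refine ContinuousOn.intervalIntegrable ?_
      rw [Set.uIcc_of_le hpi.le]
      refine continuousOn_const.sub (ContinuousOn.div (by fun_prop) (by fun_prop) fun θ hθ => ?_)
      have := hθ.1
      positivity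
    · have hθ0 := hθ.1
      have hw := three_add_mul_cos_pos hk0 hk3 (Real.pi - θ)
      simp only [hf]
      rw [Real.cos_pi_sub] at hw ⊢
      have hs := Real.sqrt_pos.2 hw
      have hs2 := Real.sq_sqrt hw.le
      have hs6 : √(3 + k * -Real.cos θ) ≤ √6 :=
        Real.sqrt_le_sqrt (by nlinarith [Real.neg_one_le_cos θ])
      have hsδ : √(3 + k * -Real.cos θ) ≤ δ + 5 / 4 * θ := by
        rw [Real.sqrt_le_left (by positivity)]
        have := Real.one_sub_sq_div_two_le_cos (x := θ)
        have h2 : k * (1 - θ ^ 2 / 2) ≤ k * Real.cos θ := mul_le_mul_of_nonneg_left this hk0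
        nlinarith [mul_nonneg hδ0.le hθ0, mul_nonneg hε0.le (sq_nonneg θ), sq_nonneg θ]
      have hdiv : 2 / (δ + 5 / 4 * θ) ≤ 2 / √(3 + k * -Real.cos θ) :=
        div_le_div_of_nonneg_left (by norm_num) hs hsδ
      have hval : (1 + k * -Real.cos θ) / √(3 + k * -Real.cos θ) =
          √(3 + k * -Real.cos θ) - 2 / √(3 + k * -Real.cos θ) := by
        rw [div_eq_iff hs.ne', sub_mul (√(3 + k * -Real.cos θ)), div_mul_cancel₀ _ hs.ne', ← sq, hs2]
        ring
      rw [hval]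
      linarith
  have hint : ∫ θ in (0 : ℝ)..Real.pi, (√6 - 2 / (δ + 5 / 4 * θ)) =
      Real.pi * √6 - 8 / 5 * (Real.log (δ + 5 / 4 * Real.pi) - Real.log δ) := by
    rw [intervalIntegral.integral_sub (by simp), integral_inv_linear hδ0]
    · simp
    · refine ContinuousOn.intervalIntegrable ?_
      rw [Set.uIcc_of_le hpi.le]
      refine ContinuousOn.div (by fun_prop) (by fun_prop) fun θ hθ => ?_
      have := hθ.1
      positivity
  have hlogδ : Real.log δ = -5 := by rw [hδ, Real.log_exp]
  have hlog : 0 ≤ Real.log (δ + 5 / 4 * Real.pi) :=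
    Real.log_nonneg (by linarith [Real.pi_gt_three])
  have h6 : √6 < 2.45 := by rw [Real.sqrt_lt' (by norm_num)]; norm_num
  have hpi' := Real.pi_lt_d2
  rw [hlogδ] at hint
  have : Real.pi * √6 < 8 := by nlinarith [Real.sqrt_nonneg 6]
  rw [hsplit]
  linarith

lemma existsUnique_drift_eq_zero : ∃ k, (0 < k ∧ k < 3) ∧ drift k = 0 ∧
    ∀ l, 0 ≤ l → l < 3 → drift l = 0 → l = k := by
  have hexp : Real.exp (-10) < 3 :=
    (Real.exp_lt_one_iff.2 (by norm_num)).trans (by norm_num)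
  have hexp' := Real.exp_pos (-10)
  obtain ⟨k, hk, hk0⟩ := intermediate_value_Icc' (show 0 ≤ 3 - Real.exp (-10) by linarith)
    (drift_continuousOn (by linarith)) ⟨drift_neg.le, drift_zero_pos.le⟩
  have hk3 : k < 3 := hk.2.trans_lt (by linarith)
  refine ⟨k, ⟨lt_of_le_of_ne hk.1 fun h => ?_, hk3⟩, hk0, fun l hl0 hl3 hl => ?_⟩
  · rw [← h] at hk0
    exact drift_zero_pos.ne' hk0
  · exact drift_strictAntiOn.injOn ⟨hl0, hl3⟩ ⟨hk.1, hk3⟩ (hl.trans hk0.symm)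

end NilpotentField

namespace NilpotentField

open Filter Topology

/-! ### Explicit solutions on the ovals -/

section Oval

variable {n r b : ℝ}

lemma three_mul_add_mul_cos_pos (hr : 0 < r) (hrn : r < 3 * n) (θ : ℝ) :
    0 < 3 * n + r * Real.cos θ := by
  nlinarith [Real.neg_one_le_cos θ]

/-- A primitive of a continuous `2π`-periodic function. -/
lemma exists_primitive_periodic {f : ℝ → ℝ} (hf : Continuous f)
    (hper : Function.Periodic f (2 * Real.pi)) :
    ∃ g : ℝ → ℝ, g 0 = 0 ∧ (∀ θ, HasDerivAt g (f θ) θ) ∧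
      ∀ θ, g (θ + 2 * Real.pi) = g θ + ∫ s in (0 : ℝ)..2 * Real.pi, f s := by
  refine ⟨fun θ => ∫ s in (0 : ℝ)..θ, f s, by simp, fun θ => ?_, fun θ => ?_⟩
  · exact hf.integral_hasStrictDerivAt 0 θ |>.hasDerivAt
  · have h1 := intervalIntegral.integral_add_adjacent_intervals (μ := MeasureTheory.volume)
      (hf.intervalIntegrable 0 θ) (hf.intervalIntegrable θ (θ + 2 * Real.pi))
    have h2 := hper.intervalIntegral_add_eq θ 0
    rw [zero_add] at h2
    change ∫ s in (0 : ℝ)..θ + 2 * Real.pi, f s = (∫ s in (0 : ℝ)..θ, f s) + _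
    rw [← h1, h2]

/-- The solution of `θ' = √(3 n + r cos θ)` with `θ(0) = 0`. -/
lemma exists_phase (hr : 0 < r) (hrn : r < 3 * n) :
    ∃ (Θ : ℝ → ℝ) (T : ℝ), (∀ t, HasDerivAt Θ √(3 * n + r * Real.cos (Θ t)) t) ∧ Θ 0 = 0 ∧
      0 < T ∧ (∀ t, Θ (t + T) = Θ t + 2 * Real.pi) ∧ StrictMono Θ ∧ Function.Surjective Θ := by
  have hW := fun θ => Real.sqrt_pos.2 (three_mul_add_mul_cos_pos hr hrn θ)
  have hc : Continuous fun θ => (√(3 * n + r * Real.cos θ))⁻¹ :=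
    Continuous.inv₀ (by fun_prop) fun θ => (hW θ).ne'
  -- `g` is the time as a function of the phase; its inverse is `Θ`, and the time `g (2 π)` of one
  -- turn is the period.
  obtain ⟨g, g0, hg, hgper⟩ := exists_primitive_periodic hc (fun θ => by simp)
  have hcont : Continuous g := continuous_iff_continuousAt.2 fun θ => (hg θ).continuousAt
  have hmono : StrictMono g := strictMono_of_hasDerivAt_pos hg fun θ => inv_pos.2 (hW θ)
  -- A positive lower bound for `g'`, which makes `g` unbounded on both sides.
  set c := (√(3 * n + r))⁻¹
  have hc0 : 0 < c := inv_pos.2 (Real.sqrt_pos.2 (by linarith))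
  have hlow : ∀ x y, x ≤ y → c * (y - x) ≤ g y - g x := fun x y hxy =>
    mul_sub_le_image_sub_of_le_deriv (fun θ => (hg θ).differentiableAt) (fun θ => by
      rw [(hg θ).deriv]
      exact inv_anti₀ (hW θ) (Real.sqrt_le_sqrt (by nlinarith [Real.cos_le_one θ]))) hxy
  have hsurj : Function.Surjective g := by
    refine hcont.surjective ?_ ?_
    · refine tendsto_atTop_mono' _ ?_ (tendsto_id.const_mul_atTop hc0)
      filter_upwards [eventually_ge_atTop 0] with x hx
      have := hlow 0 x hx
      simp only [g0, sub_zero] at this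
      exact this
    · refine tendsto_atBot_mono' _ ?_ (tendsto_id.const_mul_atBot hc0)
      filter_upwards [eventually_le_atBot 0] with x hx
      have := hlow x 0 hx
      simp only [g0, id] at this ⊢
      linarith
  set e := hmono.orderIsoOfSurjective g hsurj
  have he : ∀ t, g (e.symm t) = t := fun t => e.apply_symm_apply t
  refine ⟨e.symm, g (2 * Real.pi), fun t => ?_, ?_, ?_, fun t => ?_, e.symm.strictMono,
    e.symm.surjective⟩
  · have := HasDerivAt.of_local_left_inverse (f := g) (g := e.symm) (a := t)
      e.symm.continuous.continuousAt (hg _) (inv_pos.2 (hW _)).ne' (Eventually.of_forall he)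
    rwa [inv_inv] at this
  · exact hmono.injective (by rw [he, g0])
  · rw [← g0]; exact hmono (by positivity)
  · have h2 := hgper 0
    rw [zero_add, g0, zero_add] at h2
    exact hmono.injective (by rw [he, hgper, he, ← h2])

/-- The integrand is `u / θ'`, the derivative of `x` with respect to the phase. Scaling by `n`
extracts `n` from the numerator and `√n` from the denominator. -/
lemma integral_velocity_eq (hr : 0 < r) (hrn : r < 3 * n) :
    ∫ θ in (0 : ℝ)..2 * Real.pi, (-n - r * Real.cos θ) / √(3 * n + r * Real.cos θ) =
      -√n * drift (r / n) := by
  have hn : 0 < n := by linarith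
  have hs := Real.sqrt_pos.2 hn
  rw [drift, ← intervalIntegral.integral_const_mul]
  refine intervalIntegral.integral_congr fun θ _ => ?_
  change (-n - r * Real.cos θ) / √(3 * n + r * Real.cos θ) =
    -√n * ((1 + r / n * Real.cos θ) / √(3 + r / n * Real.cos θ))
  have h1 : 3 * n + r * Real.cos θ = n * (3 + r / n * Real.cos θ) := by field_simp
  have h2 : -n - r * Real.cos θ = -n * (1 + r / n * Real.cos θ) := by field_simp; ring
  have h3 : 0 < 3 + r / n * Real.cos θ :=
    (mul_pos_iff_of_pos_left hn).1 (h1 ▸ three_mul_add_mul_cos_pos hr hrn θ)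
  rw [h1, h2, Real.sqrt_mul hn.le]
  have h4 := Real.sqrt_pos.2 h3
  have h5 := Real.sq_sqrt hn.le
  rw [← mul_div_assoc, div_eq_div_iff (by positivity) (by positivity)]
  linear_combination -(1 + r / n * Real.cos θ) * √(3 + r / n * Real.cos θ) * h5.symm

/-- Solving for `cos θ` and `sin θ` turns the equation of the oval into `cos² + sin² = 1`; here `2 n
- u = 3 n + r cos θ`. -/
lemma exists_angle (hr : 0 < r) {p : Space} (hp : p ∈ ovalCylinder n r) :
    ∃ θ, p 1 = -n - r * Real.cos θ ∧
      p 2 = r * Real.sin θ * √(3 * n + r * Real.cos θ) := by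
  obtain ⟨hp1, hp2⟩ := hp
  have hd : 0 < 2 * n - p 1 := by linarith
  have hs := Real.sqrt_pos.2 hd
  have hs2 := Real.sq_sqrt hd.le
  set c := (-n - p 1) / r
  set s := p 2 / (r * √(2 * n - p 1))
  have hcs : c ^ 2 + s ^ 2 = 1 := by
    simp only [c, s, div_pow, mul_pow, hs2]
    rw [hp1, mul_div_mul_right _ _ hd.ne']
    field_simp
    ring
  obtain ⟨θ, hθ⟩ := (Complex.norm_eq_one_iff (⟨c, s⟩ : ℂ)).1 (by
    rw [Complex.norm_eq_sqrt_sq_add_sq, hcs, Real.sqrt_one])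
  have hc : Real.cos θ = c := by rw [← Complex.exp_ofReal_mul_I_re, hθ]
  have hsn : Real.sin θ = s := by rw [← Complex.exp_ofReal_mul_I_im, hθ]
  have hcr : r * c = -n - p 1 := mul_div_cancel₀ _ hr.ne'
  refine ⟨θ, by rw [hc, hcr]; ring, ?_⟩
  rw [hc, hsn, hcr, show 3 * n + (-n - p 1) = 2 * n - p 1 by ring]
  simp only [s]
  field_simp

/-- Every oval cylinder is invariant, and the solutions on it are periodic with a common minimal
period `T`, up to a translation in `x` by `-√n * drift (r / n)` over each period. -/
lemma exists_oval_solutions (hr : 0 < r) (hrn : r < 3 * n) (hb : 3 * n ^ 2 + r ^ 2 = -2 * b) :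
    ∃ T, 0 < T ∧ ∀ p ∈ ovalCylinder n r, ∃ γ : ℝ → Space, γ 0 = p ∧
      (∀ t, HasDerivAt γ (normalField (3 / 2) b (γ t)) t) ∧ (∀ t, γ t ∈ ovalCylinder n r) ∧
      (∀ t, γ (t + T) = ![γ t 0 + -√n * drift (r / n), γ t 1, γ t 2]) ∧
      ∀ s, 0 < s → s < T → ¬ Function.Periodic γ s := by
  obtain ⟨Θ, T, hΘ, hΘ0, hT, hΘT, hΘm, hΘs⟩ := exists_phase hr hrn
  have hpos := three_mul_add_mul_cos_pos hr hrn
  have hW := fun θ => Real.sqrt_pos.2 (hpos θ)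
  obtain ⟨X, -, hX, hXT⟩ := exists_primitive_periodic
    (f := fun θ => (-n - r * Real.cos θ) / √(3 * n + r * Real.cos θ))
    (Continuous.div (by fun_prop) (by fun_prop) fun θ => (hW θ).ne') (fun θ => by simp)
  rw [integral_velocity_eq hr hrn] at hXT
  refine ⟨T, hT, fun p hp => ?_⟩
  obtain ⟨θ₀, h1, h2⟩ := exists_angle hr hp
  -- All solutions on the cylinder use the same phase function, up to the time shift `t₀`; this is
  -- why their period is common.
  obtain ⟨t₀, rfl⟩ := hΘs θ₀
  refine ⟨fun t => ![p 0 - X (Θ t₀) + X (Θ (t + t₀)), -n - r * Real.cos (Θ (t + t₀)),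
    r * Real.sin (Θ (t + t₀)) * √(3 * n + r * Real.cos (Θ (t + t₀)))], ?_, fun t => ?_,
    fun t => ?_, fun t => ?_, fun s hs0 hsT hper => ?_⟩
  · ext i; fin_cases i <;> simp [h1, h2]
  · rw [hasDerivAt_normalField_iff]
    have hθ : HasDerivAt (fun t => Θ (t + t₀)) √(3 * n + r * Real.cos (Θ (t + t₀))) t :=
      (hΘ (t + t₀)).comp_add_const t t₀
    have hne := (hW (Θ (t + t₀))).ne'
    have hsq := Real.sq_sqrt (hpos (Θ (t + t₀))).le
    have htrig := Real.sin_sq_add_cos_sq (Θ (t + t₀))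
    refine ⟨?_, ?_, ?_⟩
    · simp only [Matrix.cons_val_zero, Matrix.cons_val_one]
      refine (((hX _).comp t hθ).const_add (p 0 - X (Θ t₀))).congr_deriv ?_
      exact div_mul_cancel₀ _ hne
    · simp only [Matrix.cons_val_one, Matrix.cons_val]
      refine ((hθ.cos.const_mul r).const_sub (-n)).congr_deriv ?_
      ring
    · simp only [Matrix.cons_val_one, Matrix.cons_val]
      have hw := ((hθ.cos.const_mul r).const_add (3 * n)).sqrt (hpos _).ne'
      refine ((hθ.sin.const_mul r).mul hw).congr_deriv ?_
      generalize Real.cos (Θ (t + t₀)) = c at *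
      generalize Real.sin (Θ (t + t₀)) = s at *
      generalize √(3 * n + r * c) = w at *
      field_simp
      linear_combination 2 * r * c * hsq - r ^ 2 * htrig - hb
  · have hsq := Real.sq_sqrt (hpos (Θ (t + t₀))).le
    have htrig := Real.sin_sq_add_cos_sq (Θ (t + t₀))
    constructor
    · simp only [Matrix.cons_val_one, Matrix.cons_val]
      rw [mul_pow, hsq]
      linear_combination r ^ 2 * (3 * n + r * Real.cos (Θ (t + t₀))) * htrig
    · simp only [Matrix.cons_val_one, Matrix.cons_val_zero]
      linarith [hpos (Θ (t + t₀))]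
  · have e : Θ (t + T + t₀) = Θ (t + t₀) + 2 * Real.pi := by rw [← hΘT]; ring_nf
    simp only [e, hXT, Real.cos_add_two_pi, Real.sin_add_two_pi]
    ext i; fin_cases i <;> simp
    ring
  -- At time `-t₀` the phase is `0` and `u` is minimal. A period `s < T` would make `u` minimal
  -- again at a phase strictly between `0` and `2 π`.
  · have h := congrFun (hper (-t₀)) 1
    simp only [Matrix.cons_val_one, Matrix.cons_val_zero, neg_add_cancel, hΘ0, Real.cos_zero] at h
    rw [show -t₀ + s + t₀ = s by ring] at h
    have hcos : Real.cos (Θ s) = 1 := mul_left_cancel₀ hr.ne' (by linarith)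
    have hs1 : 0 < Θ s := hΘ0 ▸ hΘm hs0
    have hs2 : Θ s < 2 * Real.pi := by
      have h2 := hΘT 0
      rw [zero_add, hΘ0, zero_add] at h2
      rw [← h2]; exact hΘm hsT
    exact hs1.ne' ((Real.cos_eq_one_iff_of_lt_of_lt (by linarith [Real.pi_pos]) hs2).1 hcos)

end Oval

/-! ### Classification of the returning trajectories for `b < 0` -/

/-- The zero of `drift` fixes the shape `k = r / n`; then `n² (3 + k²) = -2 b` fixes the size. -/
lemma existsUnique_closed_oval {b : ℝ} (hb : b < 0) :
    ∃ n r : ℝ, 0 < r ∧ r < 3 * n ∧ 3 * n ^ 2 + r ^ 2 = -2 * b ∧ drift (r / n) = 0 ∧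
      ∀ n' r' : ℝ, 0 < r' → r' < 3 * n' → 3 * n' ^ 2 + r' ^ 2 = -2 * b → drift (r' / n') = 0 →
        n' = n ∧ r' = r := by
  obtain ⟨k, ⟨hk0, hk3⟩, hk, huniq⟩ := existsUnique_drift_eq_zero
  have hq : 0 < -2 * b / (3 + k ^ 2) := div_pos (by linarith) (by positivity)
  set n := √(-2 * b / (3 + k ^ 2))
  have hn : 0 < n := Real.sqrt_pos.2 hq
  have hn2 : n ^ 2 * (3 + k ^ 2) = -2 * b := by
    rw [Real.sq_sqrt hq.le, div_mul_cancel₀ _ (by positivity)]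
  refine ⟨n, k * n, by positivity, by nlinarith, by linear_combination hn2,
    by rwa [mul_div_cancel_right₀ _ hn.ne'], fun n' r' hr' hrn' hb' hd' => ?_⟩
  have hn' : 0 < n' := by linarith
  have hk' : r' / n' = k := huniq _ (by positivity) (by rwa [div_lt_iff₀ hn']) hd'
  have hr : r' = k * n' := by rw [← hk', div_mul_cancel₀ _ hn'.ne']
  have hsq : n' ^ 2 = n ^ 2 := by
    refine mul_right_cancel₀ (b := 3 + k ^ 2) (by positivity) ?_
    rw [hn2, ← hb', hr]; ring
  have hnn : n' = n := (pow_left_inj₀ hn'.le hn.le two_ne_zero).1 hsq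
  exact ⟨hnn, by rw [hr, hnn]⟩

/-- `f t - (D / T) t` is periodic and continuous, hence bounded; so `|f|` tends to infinity unless
`D = 0`. -/
lemma eq_zero_of_frequently_of_translation {f : ℝ → ℝ} (hf : Continuous f) {T D C : ℝ}
    (hT : 0 < T) (hD : ∀ t, f (t + T) = f t + D) (hC : ∃ᶠ t in atTop, |f t| ≤ C) : D = 0 := by
  by_contra hne
  have hper : Function.Periodic (fun t => f t - D / T * t) T := fun t => by
    simp only [hD]; field_simp; ring
  obtain ⟨B, hB⟩ := (hper.compact_of_continuous hT.ne' (by fun_prop)).isBounded.exists_norm_le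
  refine not_tendsto_abs_atTop hC ?_
  have hlin : Tendsto (fun t : ℝ => |D / T| * t - B) atTop atTop :=
    tendsto_atTop_add_const_right _ _
      (tendsto_id.const_mul_atTop (abs_pos.2 (div_ne_zero hne hT.ne')))
  refine tendsto_atTop_mono' _ ?_ hlin
  filter_upwards [eventually_ge_atTop 0] with t ht
  have h1 : |f t - D / T * t| ≤ B := hB _ ⟨t, rfl⟩
  have h2 : |D / T| * t = |D / T * t| := by rw [abs_mul, abs_of_nonneg ht]
  have h3 := abs_sub_abs_le_abs_sub (D / T * t) (f t)
  rw [abs_sub_comm] at h3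
  linarith

/-- By uniqueness the trajectory is an explicit solution on some oval cylinder. Its `x` is bounded
at late times, so the displacement per turn is zero, which singles out the oval. -/
lemma IsTrajectory.mem_ovalCylinder {b : ℝ} (hb : b < 0) {n r : ℝ}
    (huniq : ∀ n' r' : ℝ, 0 < r' → r' < 3 * n' → 3 * n' ^ 2 + r' ^ 2 = -2 * b →
      drift (r' / n') = 0 → n' = n ∧ r' = r)
    {γ : ℝ → Space} {I : Set ℝ} (h : IsTrajectory (normalField (3 / 2) b) γ I)
    (hret : ReturnsForward γ I) : ∀ t ∈ I, γ t ∈ ovalCylinder n r := by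
  obtain ⟨n', r', hr', hrn', hb', s, hs, hsm⟩ := h.exists_oval hb hret
  obtain ⟨T, hT, hsol⟩ := exists_oval_solutions hr' hrn' hb'
  obtain ⟨δ, hδ0, hδ, hδm, hδT, -⟩ := hsol _ hsm
  have heq : Set.EqOn γ (fun t => δ (t - s)) I := by
    refine IsSolutionOn.eqOn (contDiff_normalField _ _) h.toIsSolutionOn
      ⟨h.isOpen, h.ordConnected, h.nonempty, fun t _ => (hδ (t - s)).comp_sub_const t s⟩ hs ?_
    simp [hδ0]
  have hI := h.Ici_subset (contDiff_normalField _ _) hret hs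
  obtain ⟨C, hC⟩ := hret.frequently hI
  have hcont : Continuous δ := continuous_iff_continuousAt.2 fun t => (hδ t).continuousAt
  have hD : -√n' * drift (r' / n') = 0 := by
    refine eq_zero_of_frequently_of_translation (f := fun t => δ (t - s) 0) (T := T) (C := C)
      (by fun_prop) hT (fun t => ?_) ?_
    · rw [show t + T - s = t - s + T by ring, hδT]; simp
    · refine ((hC 0).and_eventually (eventually_ge_atTop s)).mono fun t ht => ?_
      have := heq (hI ht.2)
      simp only at this
      rw [← this]; exact ht.1
  have hn' : 0 < n' := by linarith
  have hd : drift (r' / n') = 0 := by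
    rcases mul_eq_zero.1 hD with h0 | h0
    · exact absurd h0 (neg_ne_zero.2 (Real.sqrt_pos.2 hn').ne')
    · exact h0
  obtain ⟨rfl, rfl⟩ := huniq n' r' hr' hrn' hb' hd
  intro t ht
  rw [heq ht]
  exact hδm _

end NilpotentField

namespace NilpotentField

open Filter Topology

/-! ### The isochronous cylinder -/

section Cylinder

variable {n r : ℝ}

/-- The defining function of `ovalCylinder`. -/
def ovalFun (n r : ℝ) (p : Space) : ℝ := p 2 ^ 2 - (r ^ 2 - (p 1 + n) ^ 2) * (2 * n - p 1)

lemma contDiff_ovalFun (n r : ℝ) {m : WithTop ℕ∞} : ContDiff ℝ m (ovalFun n r) := by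
  unfold ovalFun
  fun_prop

lemma ovalFun_eq_zero {p : Space} (hp : p ∈ ovalCylinder n r) : ovalFun n r p = 0 :=
  sub_eq_zero.2 hp.1

/-- The cubic has a second, unbounded branch on `u ≥ 2 n`. This bound replaces the open condition `u
< 2 n` by a closed one, which makes the cylinder a closed set. -/
lemma add_le_of_mem_ovalCylinder (hr : 0 < r) {p : Space} (hp : p ∈ ovalCylinder n r) :
    p 1 + n ≤ r := by
  obtain ⟨h1, h2⟩ := hp
  by_contra hcon
  have h3 : 0 < ((p 1 + n) ^ 2 - r ^ 2) * (2 * n - p 1) :=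
    mul_pos (by nlinarith) (by linarith)
  nlinarith [sq_nonneg (p 2)]

/-- At a critical point `v = 0` and `u` is a double root of the cubic; but `-n ± r` are distinct and
the root `2 n` is not on the oval. -/
lemma fderiv_ovalFun_ne_zero (hr : 0 < r) {p : Space}
    (hp : p ∈ ovalCylinder n r) : fderiv ℝ (ovalFun n r) p ≠ 0 := by
  intro h0
  have hd : HasFDerivAt (ovalFun n r) (0 : Space →L[ℝ] ℝ) p := by
    rw [← h0]
    exact ((contDiff_ovalFun n r (m := 1)).differentiable one_ne_zero p).hasFDerivAt
  have hline : ∀ w : Space, HasDerivAt (fun s : ℝ => ovalFun n r (p + s • w)) 0 0 := fun w => by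
    have h1 : HasDerivAt (fun s : ℝ => p + s • w) w 0 := by
      simpa using ((hasDerivAt_id (0 : ℝ)).smul_const w).const_add p
    have h2 : HasFDerivAt (ovalFun n r) (0 : Space →L[ℝ] ℝ) (p + (0 : ℝ) • w) := by simpa using hd
    exact h2.comp_hasDerivAt 0 h1
  have hv := hline ![0, 0, 1]
  have hu := hline ![0, 1, 0]
  simp only [ovalFun, Pi.add_apply, Pi.smul_apply, smul_eq_mul, Matrix.cons_val, Matrix.cons_val_one,
    Matrix.cons_val_zero, mul_zero, mul_one, add_zero] at hv hu
  have hid := hasDerivAt_id (0 : ℝ)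
  have hv' := ((hid.const_add (p 2)).pow 2).sub_const ((r ^ 2 - (p 1 + n) ^ 2) * (2 * n - p 1))
  have hu' := ((((hid.const_add (p 1)).add_const n).pow 2).const_sub (r ^ 2)).mul
    ((hid.const_add (p 1)).const_sub (2 * n)) |>.const_sub (p 2 ^ 2)
  have e1 := hv.unique hv'
  have e2 := hu.unique hu'
  simp at e1 e2
  obtain ⟨h1, h2⟩ := hp
  rw [e1] at h1
  have hle := add_le_of_mem_ovalCylinder hr ⟨by rw [e1, ← h1], h2⟩
  have h3 : r ^ 2 - (p 1 + n) ^ 2 = 0 := by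
    rcases mul_eq_zero.1 (show (r ^ 2 - (p 1 + n) ^ 2) * (2 * n - p 1) = 0 by rw [← h1]; simp)
      with h | h
    · exact h
    · linarith
  have h4 : (p 1 + n) * (2 * n - p 1) = 0 := by nlinarith
  rcases mul_eq_zero.1 h4 with h | h
  · rw [h] at h3
    nlinarith
  · linarith

lemma isRegularSurface_ovalCylinder (hr : 0 < r) (hrn : r < 3 * n) :
    IsRegularSurface (ovalCylinder n r) := by
  refine ⟨⟨![0, r - n, 0], ?_⟩, ?_, fun p hp => ?_⟩
  · constructor
    · simp
    · simp; linarith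
  · have : ovalCylinder n r = {p | ovalFun n r p = 0} ∩ {p | p 1 + n ≤ r} := by
      ext p
      refine ⟨fun hp => ⟨ovalFun_eq_zero hp, add_le_of_mem_ovalCylinder hr hp⟩, fun hp => ?_⟩
      exact ⟨sub_eq_zero.1 hp.1, by have := hp.2; change p 1 + n ≤ r at this; linarith⟩
    rw [this]
    exact (isClosed_eq (contDiff_ovalFun n r (m := 1)).continuous continuous_const).inter
      (isClosed_le (by fun_prop) continuous_const)
  · have hc : Continuous (fderiv ℝ (ovalFun n r)) :=
      (contDiff_ovalFun n r (m := 1)).continuous_fderiv one_ne_zero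
    refine ⟨{q | q 1 < 2 * n} ∩ {q | fderiv ℝ (ovalFun n r) q ≠ 0},
      (isOpen_lt (by fun_prop) continuous_const).inter (isOpen_ne_fun hc continuous_const),
      ⟨hp.2, fderiv_ovalFun_ne_zero hr hp⟩, ovalFun n r,
      (contDiff_ovalFun n r).contDiffOn, fun q hq => hq.2, ?_⟩
    ext q
    exact ⟨fun hq => ⟨hq.2, ovalFun_eq_zero hq.1⟩,
      fun hq => ⟨⟨sub_eq_zero.1 hq.2, hq.1.1⟩, hq.1⟩⟩

/-- The coordinates are `x` and `exp (i θ)`, with the angle of `exists_angle`. -/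
lemma nonempty_homeomorph_ovalCylinder (hr : 0 < r) (hrn : r < 3 * n) :
    Nonempty (ovalCylinder n r ≃ₜ ℝ × Circle) := by
  have hd : ∀ p : ovalCylinder n r, 0 < 2 * n - p.1 1 := fun p => by linarith [p.2.2]
  have hmem : ∀ p : ovalCylinder n r, (⟨(-n - p.1 1) / r, p.1 2 / (r * √(2 * n - p.1 1))⟩ : ℂ) ∈
      Submonoid.unitSphere ℂ := fun p => by
    obtain ⟨hp1, -⟩ := p.2
    have hs2 := Real.sq_sqrt (hd p).le
    have hcs : ((-n - p.1 1) / r) ^ 2 + (p.1 2 / (r * √(2 * n - p.1 1))) ^ 2 = 1 := by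
      simp only [div_pow, mul_pow, hs2]
      rw [hp1, mul_div_mul_right _ _ (hd p).ne']
      field_simp
      ring
    rw [← SetLike.mem_coe, Submonoid.coe_unitSphere, mem_sphere_zero_iff_norm, Complex.norm_eq_sqrt_sq_add_sq, hcs, Real.sqrt_one]
  have hcirc : ∀ z : Circle, (z : ℂ).re ^ 2 + (z : ℂ).im ^ 2 = 1 := fun z => by
    have := z.normSq_coe
    rw [Complex.normSq_apply] at this
    linarith
  have hre : ∀ z : Circle, 0 < 3 * n + r * (z : ℂ).re := fun z => by
    have h1 : -1 ≤ (z : ℂ).re := by nlinarith [hcirc z, sq_nonneg (z : ℂ).im]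
    nlinarith
  refine ⟨⟨⟨fun p => (p.1 0, ⟨_, hmem p⟩), fun q => ⟨![q.1, -n - r * (q.2 : ℂ).re,
    r * (q.2 : ℂ).im * √(3 * n + r * (q.2 : ℂ).re)], ?_, ?_⟩, fun p => ?_, fun q => ?_⟩, ?_, ?_⟩⟩
  · simp only [Matrix.cons_val_one, Matrix.cons_val_zero, Matrix.cons_val]
    rw [mul_pow, Real.sq_sqrt (hre q.2).le]
    linear_combination r ^ 2 * (3 * n + r * (q.2 : ℂ).re) * hcirc q.2
  · simp only [Matrix.cons_val_one, Matrix.cons_val_zero]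
    linarith [hre q.2]
  · have hs := Real.sqrt_pos.2 (hd p)
    have h1 : r * ((-n - p.1 1) / r) = -n - p.1 1 := mul_div_cancel₀ _ hr.ne'
    refine Subtype.ext (funext fun i => ?_)
    fin_cases i
    · rfl
    · change -n - r * ((-n - p.1 1) / r) = p.1 1
      rw [h1]; ring
    · change r * (p.1 2 / (r * √(2 * n - p.1 1))) * √(3 * n + r * ((-n - p.1 1) / r)) = p.1 2
      rw [h1, show 3 * n + (-n - p.1 1) = 2 * n - p.1 1 by ring]
      field_simp
  · have hs := Real.sqrt_pos.2 (hre q.2)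
    refine Prod.ext rfl (Subtype.ext (Complex.ext ?_ ?_))
    · change (-n - (-n - r * (q.2 : ℂ).re)) / r = (q.2 : ℂ).re
      field_simp
      ring
    · change r * (q.2 : ℂ).im * √(3 * n + r * (q.2 : ℂ).re) /
        (r * √(2 * n - (-n - r * (q.2 : ℂ).re))) = (q.2 : ℂ).im
      rw [show 2 * n - (-n - r * (q.2 : ℂ).re) = 3 * n + r * (q.2 : ℂ).re by ring]
      field_simp
  · have hc : ∀ i, Continuous fun p : ovalCylinder n r => p.1 i := fun i =>
      (continuous_apply i).comp continuous_subtype_val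
    have h1 := hc 1
    have h2 := hc 2
    refine (hc 0).prodMk (Continuous.subtype_mk (Continuous.congr (f := fun p : ovalCylinder n r =>
      (((-n - p.1 1) / r : ℝ) : ℂ) + ((p.1 2 / (r * √(2 * n - p.1 1)) : ℝ) : ℂ) * Complex.I)
      ?_ fun p => (Complex.mk_eq_add_mul_I _ _).symm) _)
    refine (Complex.continuous_ofReal.comp ((continuous_const.sub h1).div_const r)).add
      ((Complex.continuous_ofReal.comp (h2.div ?_ fun p => ?_)).mul continuous_const)
    · exact continuous_const.mul (continuous_const.sub h1).sqrt
    · exact (mul_pos hr (Real.sqrt_pos.2 (hd p))).ne'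
  · have h1 : Continuous fun q : ℝ × Circle => (q.2 : ℂ).re :=
      Complex.continuous_re.comp (continuous_subtype_val.comp continuous_snd)
    have h2 : Continuous fun q : ℝ × Circle => (q.2 : ℂ).im :=
      Complex.continuous_im.comp (continuous_subtype_val.comp continuous_snd)
    refine Continuous.subtype_mk (continuous_pi fun i => ?_) _
    fin_cases i
    · exact continuous_fst
    · exact continuous_const.sub (continuous_const.mul h1)
    · exact (continuous_const.mul h2).mul (continuous_const.add (continuous_const.mul h1)).sqrt

end Cylinder

/-! ### A regular surface inside another one is open in it -/

/-- Two hyperplanes do not cover the space. The vector serves as a direction transversal to two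
surfaces at once. -/
lemma exists_apply_ne_zero_of_ne_zero {E : Type*} [AddCommGroup E] [Module ℝ E]
    [TopologicalSpace E] {L M : E →L[ℝ] ℝ} (hL : L ≠ 0) (hM : M ≠ 0) :
    ∃ w, 0 < L w ∧ M w ≠ 0 := by
  suffices ∃ w, L w ≠ 0 ∧ M w ≠ 0 by
    obtain ⟨w, h1, h2⟩ := this
    rcases lt_or_gt_of_ne h1 with h | h
    · exact ⟨-w, by simpa using h, by simpa using h2⟩
    · exact ⟨w, h, h2⟩
  obtain ⟨w₁, h1⟩ : ∃ w, L w ≠ 0 := by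
    by_contra hcon
    push Not at hcon
    exact hL (ContinuousLinearMap.ext hcon)
  obtain ⟨w₂, h2⟩ : ∃ w, M w ≠ 0 := by
    by_contra hcon
    push Not at hcon
    exact hM (ContinuousLinearMap.ext hcon)
  by_cases h3 : M w₁ = 0
  · by_cases h4 : L w₂ = 0
    · exact ⟨w₁ + w₂, by simpa [h4] using h1, by simpa [h3] using h2⟩
    · exact ⟨w₂, h4, h2⟩
  · exact ⟨w₁, h1, h3⟩

lemma exists_ball_injective_along {ψ : Space → ℝ} {M : Space →L[ℝ] ℝ} {p w : Space}
    (hψ : HasStrictFDerivAt ψ M p) (hw : M w ≠ 0) :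
    ∃ ρ > 0, ∀ q ∈ Metric.ball p ρ, ∀ s : ℝ, q + s • w ∈ Metric.ball p ρ →
      ψ (q + s • w) = ψ q → s = 0 := by
  have hw0 : 0 < |M w| := abs_pos.2 hw
  -- With this constant the linearization error along `s • w` is at most `|s| |M w| / 2`, too small
  -- to cancel `s M w`.
  have hε : 0 < |M w| / (2 * (‖w‖ + 1)) := by positivity
  have h := hψ.isLittleO.def hε
  rw [Metric.eventually_nhds_iff] at h
  obtain ⟨ρ, hρ, h⟩ := h
  refine ⟨ρ, hρ, fun q hq s hs heq => ?_⟩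
  have h1 := @h (q + s • w, q) (by
    rw [Prod.dist_eq]
    exact max_lt hs hq)
  simp only [heq, sub_self, add_sub_cancel_left, map_smul, smul_eq_mul, zero_sub, norm_neg,
    norm_mul, norm_smul, Real.norm_eq_abs] at h1
  by_contra hne
  have hs0 : 0 < |s| := abs_pos.2 hne
  have h2 : |M w| / (2 * (‖w‖ + 1)) * ‖w‖ ≤ |M w| / 2 := by
    rw [div_mul_eq_mul_div, div_le_div_iff₀ (by positivity) (by norm_num)]
    nlinarith [norm_nonneg w]
  nlinarith

/-- The values of `g` at `p ± η w` have opposite signs if `g p = 0` and `dg(p) w > 0`. -/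
lemma exists_sign_change {g : Space → ℝ} {L : Space →L[ℝ] ℝ} {p w : Space}
    (hg : HasFDerivAt g L p) (hp : g p = 0) (hw : 0 < L w) {κ : ℝ} (hκ : 0 < κ) :
    ∃ η, 0 < η ∧ η < κ ∧ 0 < g (p + η • w) ∧ g (p + -η • w) < 0 := by
  have hline : HasDerivAt (fun s : ℝ => g (p + s • w)) (L w) 0 := by
    have h1 : HasDerivAt (fun s : ℝ => p + s • w) w 0 := by
      simpa using ((hasDerivAt_id (0 : ℝ)).smul_const w).const_add p
    have h2 : HasFDerivAt g L (p + (0 : ℝ) • w) := by simpa using hg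
    exact h2.comp_hasDerivAt 0 h1
  have h := (hline.isLittleO.def (half_pos hw))
  rw [Metric.eventually_nhds_iff] at h
  obtain ⟨ρ, hρ, h⟩ := h
  have hη : 0 < min ρ κ / 2 := by positivity
  have hηρ : min ρ κ / 2 < ρ := by linarith [min_le_left ρ κ]
  refine ⟨min ρ κ / 2, hη, by linarith [min_le_right ρ κ], ?_, ?_⟩
  · have h1 := @h (min ρ κ / 2) (by rw [Real.dist_eq, sub_zero, abs_of_pos hη]; exact hηρ)
    simp only [zero_smul, add_zero, hp, sub_zero, smul_eq_mul, Real.norm_eq_abs,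
      abs_of_pos hη] at h1
    nlinarith [(abs_le.1 h1).1, mul_pos hη hw]
  · have h1 := @h (-(min ρ κ / 2)) (by
      rw [Real.dist_eq, sub_zero, abs_neg, abs_of_pos hη]; exact hηρ)
    simp only [zero_smul, add_zero, hp, sub_zero, smul_eq_mul, Real.norm_eq_abs, abs_neg,
      abs_of_pos hη] at h1
    nlinarith [(abs_le.1 h1).2, mul_pos hη hw]

/-- Take a direction `w` transversal to both surfaces at `p`. For `q ∈ Z` near `p`, the local
equation `g` of `S` changes sign along the short segment through `q` in direction `w`, so the
segment meets `S ⊆ Z`. Since `ψ` is injective along the segment, it meets `Z` only at `q`; hence `q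
∈ S`. -/
lemma exists_isOpen_inter_subset {S Z : Set Space} {ψ : Space → ℝ} (hψ : ContDiff ℝ 1 ψ)
    (hZ : ∀ q ∈ Z, ψ q = 0) (hSZ : S ⊆ Z) (hS : IsRegularSurface S) {p : Space} (hp : p ∈ S)
    (hψp : fderiv ℝ ψ p ≠ 0) : ∃ W, IsOpen W ∧ p ∈ W ∧ Z ∩ W ⊆ S := by
  obtain ⟨U, hU, hpU, g, hg, hg', hSU⟩ := hS.2.2 p hp
  have hmem : ∀ q ∈ U, q ∈ S ↔ g q = 0 := fun q hq => by
    have : q ∈ S ∩ U ↔ q ∈ {q ∈ U | g q = 0} := by rw [hSU]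
    simpa [hq] using this
  have hgp : HasFDerivAt g (fderiv ℝ g p) p :=
    ((hg.contDiffAt (hU.mem_nhds hpU)).differentiableAt (by simp)).hasFDerivAt
  obtain ⟨w, hw1, hw2⟩ := exists_apply_ne_zero_of_ne_zero (hg' p hpU) hψp
  obtain ⟨ρ, hρ, hinj⟩ := exists_ball_injective_along
    (hψ.contDiffAt.hasStrictFDerivAt one_ne_zero) hw2
  obtain ⟨ρ', hρ', hball⟩ := Metric.isOpen_iff.1 hU p hpU
  set σ := min ρ ρ'
  have hσ : 0 < σ := lt_min hρ hρ'
  obtain ⟨η, hη, hησ, hη1, hη2⟩ := exists_sign_change hgp ((hmem p hpU).1 hp) hw1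
    (show 0 < σ / (2 * (‖w‖ + 1)) by positivity)
  have hηw : η * ‖w‖ < σ / 2 := by
    rw [lt_div_iff₀ (by positivity)] at hησ
    nlinarith [norm_nonneg w]
  have hseg : ∀ q ∈ Metric.ball p (σ / 2), ∀ s ∈ Set.Icc (-η) η,
      q + s • w ∈ Metric.ball p σ := fun q hq s hs => by
    have h1 : |s| ≤ η := abs_le.2 hs
    rw [Metric.mem_ball, dist_eq_norm] at hq ⊢
    calc ‖q + s • w - p‖ = ‖(q - p) + s • w‖ := by congr 1; abel
      _ ≤ ‖q - p‖ + |s| * ‖w‖ := by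
        simpa [norm_smul] using norm_add_le (q - p) (s • w)
      _ < σ := by nlinarith [norm_nonneg w]
  have hσU : ∀ q ∈ Metric.ball p σ, q ∈ U := fun q hq =>
    hball (Metric.ball_subset_ball (min_le_right _ _) hq)
  have hcont : ∀ s ∈ Set.Icc (-η) η, ContinuousAt (fun q => g (q + s • w)) p := fun s hs => by
    have hq : p + s • w ∈ U := hσU _ (hseg p (Metric.mem_ball_self (half_pos hσ)) s hs)
    exact ContinuousAt.comp (f := fun q => q + s • w) (g := g)
      (hg.continuousOn.continuousAt (hU.mem_nhds hq)) (by fun_prop)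
  have e1 := (hcont η ⟨by linarith, le_rfl⟩).eventually (lt_mem_nhds hη1)
  have e2 := (hcont (-η) ⟨le_rfl, by linarith⟩).eventually (gt_mem_nhds hη2)
  have e3 := Metric.ball_mem_nhds p (half_pos hσ)
  obtain ⟨W, hWsub, hWo, hpW⟩ := mem_nhds_iff.1 (inter_mem (inter_mem e1 e2) e3)
  refine ⟨W, hWo, hpW, fun q hq => ?_⟩
  obtain ⟨⟨hq1, hq2⟩, hq3⟩ := hWsub hq.2
  have hline : ContinuousOn (fun s : ℝ => g (q + s • w)) (Set.Icc (-η) η) :=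
    hg.continuousOn.comp (by fun_prop) fun s hs => hσU _ (hseg q hq3 s hs)
  obtain ⟨s, hs, hs0⟩ := intermediate_value_Icc (by linarith) hline
    (show (0 : ℝ) ∈ _ from ⟨le_of_lt hq2, le_of_lt hq1⟩)
  have hin := hseg q hq3 s hs
  have hsS : q + s • w ∈ S := (hmem _ (hσU _ hin)).2 hs0
  have hqb : q ∈ Metric.ball p ρ :=
    Metric.ball_subset_ball ((half_le_self hσ.le).trans (min_le_left _ _)) hq3
  have := hinj q hqb s (Metric.ball_subset_ball (min_le_left _ _) hin)
    (by rw [hZ _ (hSZ hsS), hZ q hq.1])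
  rw [this, zero_smul, add_zero] at hsS
  exact hsS

/-- `S` is nonempty and closed, and open in `Z` by the local statement; `Z` is connected. -/
lemma eq_of_isRegularSurface_subset {S Z : Set Space} {ψ : Space → ℝ} (hψ : ContDiff ℝ 1 ψ)
    (hZ : ∀ q ∈ Z, ψ q = 0) (hψ' : ∀ q ∈ Z, fderiv ℝ ψ q ≠ 0) (hZc : IsPreconnected Z)
    (hSZ : S ⊆ Z) (hS : IsRegularSurface S) : S = Z := by
  choose! W hWo hpW hWS using fun p (hp : p ∈ S) =>
    exists_isOpen_inter_subset hψ hZ hSZ hS hp (hψ' p (hSZ hp))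
  refine Set.Subset.antisymm hSZ ?_
  have hu : IsOpen (⋃ p ∈ S, W p) := isOpen_biUnion hWo
  have hSu : S ⊆ ⋃ p ∈ S, W p := fun p hp => Set.mem_biUnion hp (hpW p hp)
  have hZu : Z ∩ (⋃ p ∈ S, W p) ⊆ S := by
    rintro q ⟨hqZ, hq⟩
    obtain ⟨p, hp, hqp⟩ := Set.mem_iUnion₂.1 hq
    exact hWS p hp ⟨hqZ, hqp⟩
  rcases isPreconnected_iff_subset_of_disjoint.1 hZc _ _ hu hS.2.1.isOpen_compl
    (fun q _ => by
      by_cases h : q ∈ S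
      · exact Or.inl (hSu h)
      · exact Or.inr h)
    (by
      ext q
      simp only [Set.mem_inter_iff, Set.mem_compl_iff, Set.mem_empty_iff_false, iff_false]
      exact fun h => h.2.2 (hZu ⟨h.1, h.2.1⟩)) with h | h
  · exact fun q hq => hZu ⟨hq, h hq⟩
  · obtain ⟨p, hp⟩ := hS.1
    exact absurd hp (h (hSZ hp))

/-! ### Periodic surfaces of the normal form for `b < 0` -/

lemma IsPeriodicOrbit.returnsForward {F : Space → Space} {γ : ℝ → Space} {T : ℝ}
    (h : IsPeriodicOrbit F γ T) : ReturnsForward γ Set.univ := by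
  have hc : Continuous γ := continuous_iff_continuousAt.2 fun t => (h.hasDerivAt t).continuousAt
  exact ⟨Set.range γ, h.periodic.compact_of_continuous h.pos.ne' hc,
    fun t _ => ⟨t, trivial, le_rfl, t, rfl⟩⟩

/-- The case `μ < 0` for the normal form. -/
theorem normalField_of_neg {b : ℝ} (hb : b < 0) :
    ∃ S : Set Space, IsIsochronousPeriodicSurface (normalField (3 / 2) b) S ∧
      Nonempty (S ≃ₜ ℝ × Circle) ∧
      (∀ S', IsIsochronousPeriodicSurface (normalField (3 / 2) b) S' → S' = S) ∧
      ∀ (γ : ℝ → Space) (I : Set ℝ), IsTrajectory (normalField (3 / 2) b) γ I →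
        (∀ t ∈ I, γ t ∉ S) → EscapesBothWays γ I := by
  obtain ⟨n, r, hr, hrn, hnr, hdrift, huniq⟩ := existsUnique_closed_oval hb
  obtain ⟨T, hT, hsol⟩ := exists_oval_solutions hr hrn hnr
  obtain ⟨e⟩ := nonempty_homeomorph_ovalCylinder hr hrn
  have hper : ∀ p ∈ ovalCylinder n r, ∃ γ : ℝ → Space,
      IsPeriodicOrbit (normalField (3 / 2) b) γ T ∧ γ 0 = p ∧
        Set.range γ ⊆ ovalCylinder n r := fun p hp => by
    obtain ⟨γ, h0, hγ, hm, hγT, hmin⟩ := hsol p hp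
    refine ⟨γ, ⟨hγ, hT, fun t => ?_, hmin⟩, h0, by rintro _ ⟨t, rfl⟩; exact hm t⟩
    rw [hγT, hdrift]
    ext i; fin_cases i <;> simp
  refine ⟨ovalCylinder n r, ⟨⟨isRegularSurface_ovalCylinder hr hrn, fun p hp => ?_⟩, T, ?_⟩, ⟨e⟩,
    fun S hS => ?_, fun γ I hγ hI => ?_⟩
  · obtain ⟨γ, h1, h2, h3⟩ := hper p hp
    exact ⟨γ, T, h1, h2, h3⟩
  -- By uniqueness any periodic orbit on the cylinder is one of the explicit ones, and a curve has
  -- one minimal period.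
  · intro γ T' hγ hγm
    obtain ⟨δ, hδ, hδ0, -⟩ := hper (γ 0) (hγm ⟨0, rfl⟩)
    have heq : γ = δ := funext fun t => IsSolutionOn.eqOn (contDiff_normalField _ _)
      (isTrajectory_univ hγ.hasDerivAt).toIsSolutionOn
      (isTrajectory_univ hδ.hasDerivAt).toIsSolutionOn (Set.mem_univ 0) hδ0.symm (Set.mem_univ t)
    subst heq
    rcases lt_trichotomy T' T with h | h | h
    · exact absurd hγ.periodic (hδ.minimal T' hγ.pos h)
    · exact h
    · exact absurd hδ.periodic (hγ.minimal T hδ.pos h)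
  · have hsub : S ⊆ ovalCylinder n r := fun p hp => by
      obtain ⟨γ, T', hγ, h0, -⟩ := hS.1.2 p hp
      have := (isTrajectory_univ hγ.hasDerivAt).mem_ovalCylinder hb huniq hγ.returnsForward 0
        trivial
      rwa [h0] at this
    have hconn : IsPreconnected (ovalCylinder n r) := by
      have : ConnectedSpace Circle := by
        have := Circle.exp.continuous
        have hs : Function.Surjective Circle.exp := Circle.exp_surjective
        exact hs.connectedSpace this
      have hconn : ConnectedSpace (ovalCylinder n r) :=
        e.symm.surjective.connectedSpace e.symm.continuous
      exact isPreconnected_iff_preconnectedSpace.2 inferInstance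
    exact eq_of_isRegularSurface_subset (contDiff_ovalFun n r) (fun q hq => ovalFun_eq_zero hq)
      (fun q hq => fderiv_ovalFun_ne_zero hr hq) hconn hsub hS.1.1
  · obtain ⟨t, ht⟩ := hγ.nonempty
    refine escapesBothWays_of_not_returnsForward
      (fun h => hI t ht (hγ.mem_ovalCylinder hb huniq h t ht)) fun h => hI t ht ?_
    have := hγ.reverse.mem_ovalCylinder hb huniq h (-t) (by simpa using ht)
    simpa [reflect, ovalCylinder] using this

end NilpotentField

namespace NilpotentField

/-! ### Invariant algebraic surfaces under polynomial conjugation -/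

lemma hasFDerivAt_eval (f : MvPolynomial (Fin 3) ℝ) (p : Space) :
    HasFDerivAt (fun q : Space => MvPolynomial.eval q f)
      (∑ i, MvPolynomial.eval p (MvPolynomial.pderiv i f) •
        (ContinuousLinearMap.proj i : Space →L[ℝ] ℝ)) p := by
  induction f using MvPolynomial.induction_on with
  | C a =>
    simp only [MvPolynomial.eval_C, MvPolynomial.pderiv_C, map_zero, zero_smul,
      Finset.sum_const_zero]
    exact hasFDerivAt_const a p
  | add f g hf hg =>
    simp only [map_add, add_smul, Finset.sum_add_distrib]
    exact hf.add hg
  | mul_X f j hf =>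
    have hX : HasFDerivAt (fun q : Space => q j) (ContinuousLinearMap.proj j : Space →L[ℝ] ℝ) p :=
      (ContinuousLinearMap.proj (R := ℝ) (φ := fun _ : Fin 3 => ℝ) j).hasFDerivAt
    have := hf.mul hX
    simp only [map_mul, MvPolynomial.eval_X]
    refine this.congr_fderiv ?_
    simp only [Derivation.leibniz, MvPolynomial.pderiv_X, smul_eq_mul, map_add, map_mul,
      MvPolynomial.eval_X, add_smul, Finset.sum_add_distrib, Finset.smul_sum, mul_smul]
    congr 1
    rw [Finset.sum_eq_single j]
    · simp
    · intro i _ hi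
      simp [Pi.single_eq_of_ne hi.symm]
    · simp

lemma fderiv_eval_apply (f : MvPolynomial (Fin 3) ℝ) (p v : Space) :
    fderiv ℝ (fun q : Space => MvPolynomial.eval q f) p v =
      ∑ i, v i * MvPolynomial.eval p (MvPolynomial.pderiv i f) := by
  rw [(hasFDerivAt_eval f p).fderiv]
  simp [mul_comm]

/-- `e` is a polynomial map. -/
def IsPolynomialMap (e : Space → Space) : Prop :=
  ∃ Q : Fin 3 → MvPolynomial (Fin 3) ℝ, ∀ p i, e p i = MvPolynomial.eval p (Q i)

lemma eval_bind₁_eq {e : Space → Space} {Q : Fin 3 → MvPolynomial (Fin 3) ℝ}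
    (hQ : ∀ p i, e p i = MvPolynomial.eval p (Q i)) (f : MvPolynomial (Fin 3) ℝ) (p : Space) :
    MvPolynomial.eval p (MvPolynomial.bind₁ Q f) = MvPolynomial.eval (e p) f := by
  have : e p = fun i => MvPolynomial.eval p (Q i) := funext (hQ p)
  rw [this]
  exact MvPolynomial.eval₂Hom_bind₁ (RingHom.id ℝ) p Q f

/-- Substituting the polynomial inverse into `f` and the cofactor keeps them polynomial; the chain
rule turns one invariance identity into the other. -/
lemma IsConj.isInvariantAlgebraic {e : Space ≃ Space} {F G : Space → Space} (h : IsConj e F G)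
    (hpoly : IsPolynomialMap e.symm) {S : Set Space} (hS : IsInvariantAlgebraic F S) :
    IsInvariantAlgebraic G (e '' S) := by
  obtain ⟨f, K, hdeg, hSf, hK⟩ := hS
  obtain ⟨Q, hQ⟩ := hpoly
  have hev := eval_bind₁_eq hQ
  refine ⟨MvPolynomial.bind₁ Q f, MvPolynomial.bind₁ Q K, fun h0 => hdeg ?_, ?_, fun q => ?_⟩
  · rw [MvPolynomial.totalDegree_eq_zero_iff_eq_C] at h0
    set c := (MvPolynomial.bind₁ Q f).coeff 0
    have hfc : f = MvPolynomial.C c := MvPolynomial.funext fun p => by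
      rw [← e.symm_apply_apply p, ← hev, h0]
      simp
    rw [hfc, MvPolynomial.totalDegree_C]
  · rw [e.image_eq_preimage_symm, hSf]
    ext q
    change MvPolynomial.eval (e.symm q) f = 0 ↔ MvPolynomial.eval q _ = 0
    rw [hev]
  · rw [← fderiv_eval_apply, hev, hev, ← hK, ← fderiv_eval_apply]
    have hcomp : (fun q : Space => MvPolynomial.eval q (MvPolynomial.bind₁ Q f)) =
        (fun p : Space => MvPolynomial.eval p f) ∘ e.symm := funext (hev f)
    rw [hcomp, fderiv_comp q (hasFDerivAt_eval f _).differentiableAt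
      (h.smooth_symm.differentiable (by simp) q), ContinuousLinearMap.comp_apply,
      h.symm.fderiv_apply]

/-! ### The level curves `v² = u³ + E` -/

open Polynomial

/-- The coordinate ring `ℝ[u] ⊕ ℝ[u] v` of the curve `v² = u³ + E`. -/
abbrev LevelRing (E : ℝ) : Type := QuadraticAlgebra ℝ[X] (X ^ 3 + C E) 0

section LevelRing

variable {E : ℝ}

open QuadraticAlgebra

lemma natDegree_cubic (E : ℝ) : (X ^ 3 + C E : ℝ[X]).natDegree = 3 :=
  natDegree_X_pow_add_C

lemma cubic_ne_zero (E : ℝ) : (X ^ 3 + C E : ℝ[X]) ≠ 0 := fun h => by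
  have := natDegree_cubic E
  simp [h] at this

lemma natDegree_cubic_mul_sq {b : ℝ[X]} (hb : b ≠ 0) :
    ((X ^ 3 + C E) * b ^ 2).natDegree = 3 + 2 * b.natDegree := by
  rw [natDegree_mul (cubic_ne_zero E) (pow_ne_zero 2 hb), natDegree_cubic, natDegree_pow]

/-- The two terms have degrees of different parity, so their leading terms cannot cancel, and the
odd degree is at least `3`. -/
lemma natDegree_norm {a b : ℝ[X]} (hb : b ≠ 0) :
    3 ≤ (a ^ 2 - (X ^ 3 + C E) * b ^ 2).natDegree := by
  have h1 := natDegree_cubic_mul_sq (E := E) hb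
  have h2 : (a ^ 2).natDegree = 2 * a.natDegree := natDegree_pow a 2
  rcases lt_or_gt_of_ne (show (a ^ 2).natDegree ≠ ((X ^ 3 + C E) * b ^ 2).natDegree by omega)
    with h | h
  · rw [natDegree_sub_eq_right_of_natDegree_lt h]; omega
  · rw [natDegree_sub_eq_left_of_natDegree_lt h]; omega

lemma LevelRing.norm_eq (z : LevelRing E) :
    z.norm = z.re ^ 2 - (X ^ 3 + C E) * z.im ^ 2 := by
  rw [norm_def]; ring

lemma LevelRing.eq_zero_of_norm_eq_zero {z : LevelRing E} (h : z.norm = 0) : z = 0 := by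
  rw [LevelRing.norm_eq] at h
  by_cases hb : z.im = 0
  · rw [hb] at h
    exact QuadraticAlgebra.ext (by simpa using h) hb
  · have := natDegree_norm (E := E) (a := z.re) hb
    simp [h] at this

-- The norm is multiplicative and vanishes only at `0`. This holds for `E = 0` too, and it makes
-- degrees additive in `(LevelRing E)[X]`.
instance : NoZeroDivisors (LevelRing E) where
  eq_zero_or_eq_zero_of_mul_eq_zero {z w} h := by
    have : z.norm * w.norm = 0 := by rw [← map_mul, h, QuadraticAlgebra.norm_zero]
    exact (mul_eq_zero.1 this).imp LevelRing.eq_zero_of_norm_eq_zero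
      LevelRing.eq_zero_of_norm_eq_zero

lemma C_two_eq : (C (2 : ℝ) : ℝ[X]) = 2 := rfl

lemma C_three_eq : (C (3 : ℝ) : ℝ[X]) = 3 := rfl

lemma two_mul_C_three_halves : 2 * C (3 / 2 : ℝ) = (3 : ℝ[X]) := by
  rw [← C_two_eq, ← C_three_eq, ← Polynomial.C_mul]
  norm_num

/-- The derivation `v ∂/∂u + (3/2) u² ∂/∂v` of the coordinate ring of `v² = u³ + E`. -/
noncomputable instance : Differential (LevelRing E) where
  deriv := Derivation.mk'
    { toFun := fun z => ⟨C (3 / 2) * X ^ 2 * z.im + (X ^ 3 + C E) * derivative z.im,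
        derivative z.re⟩
      map_add' := fun z w => by
        ext1
        · simp; ring
        · simp
      map_smul' := fun m z => by
        ext1
        · simp; ring
        · simp }
    fun z w => by
      have h2 := two_mul_C_three_halves
      ext1
      · simp
        ring
      · simp
        linear_combination (-X ^ 2 * z.im * w.im) * h2 + X ^ 2 * z.im * w.im * C_two_eq

open scoped Differential

lemma LevelRing.deriv_re (z : LevelRing E) :
    (z′).re = C (3 / 2) * X ^ 2 * z.im + (X ^ 3 + C E) * derivative z.im := rfl

lemma LevelRing.deriv_im (z : LevelRing E) : (z′).im = derivative z.re := rfl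

/-- The norm `N` of `z` satisfies `dN/du = 2 κ.im N`, which by degree forces `κ.im = 0` and `N`
constant. A norm with `z.im ≠ 0` has degree at least `3`, so `z` is a constant polynomial in `u`,
and then `κ = 0`. -/
lemma LevelRing.eq_const_of_deriv_eq_mul {z κ : LevelRing E} (hz : z ≠ 0) (h : z′ = κ * z) :
    κ = 0 ∧ ∃ r : ℝ, r ≠ 0 ∧ z = ⟨C r, 0⟩ := by
  have h2 := two_mul_C_three_halves
  have hre := congrArg QuadraticAlgebra.re h
  have him := congrArg QuadraticAlgebra.im h
  rw [LevelRing.deriv_re, re_mul] at hre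
  rw [LevelRing.deriv_im, im_mul] at him
  have hN0 : z.norm ≠ 0 := fun h0 => hz (LevelRing.eq_zero_of_norm_eq_zero h0)
  have hN : derivative z.norm = 2 * κ.im * z.norm := by
    rw [LevelRing.norm_eq]
    simp only [derivative_sub, derivative_pow, derivative_mul, derivative_add, derivative_X,
      derivative_C]
    simp
    rw [C_two_eq, C_three_eq]
    linear_combination 2 * z.re * him - 2 * z.im * hre + X ^ 2 * z.im ^ 2 * h2
  have hl : κ.im = 0 := by
    by_contra hl
    have hlt := degree_derivative_lt hN0
    rw [hN] at hlt
    have h3 : (2 * κ.im : ℝ[X]) ≠ 0 := mul_ne_zero two_ne_zero hl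
    rw [mul_comm] at hlt
    exact absurd (degree_le_mul_left z.norm h3) (not_le.2 hlt)
  rw [hl, mul_zero, zero_mul] at hN
  have hdeg := Polynomial.derivative_eq_zero.1 hN
  have hb : z.im = 0 := by
    by_contra hb
    have := natDegree_norm (E := E) (a := z.re) hb
    rw [← LevelRing.norm_eq] at this
    omega
  rw [LevelRing.norm_eq, hb] at hdeg
  simp only [ne_eq, OfNat.ofNat_ne_zero, not_false_eq_true, zero_pow, mul_zero, sub_zero,
    natDegree_pow, mul_eq_zero, false_or] at hdeg
  obtain ⟨r, hr⟩ := natDegree_eq_zero.1 hdeg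
  have hz' : z = ⟨C r, 0⟩ := QuadraticAlgebra.ext hr.symm hb
  have hr0 : r ≠ 0 := by
    rintro rfl
    exact hz (by rw [hz']; ext1 <;> simp)
  refine ⟨QuadraticAlgebra.ext ?_ hl, r, hr0, hz'⟩
  rw [hb, hl, ← hr] at hre
  have : κ.re * C r = 0 := by simpa using hre.symm
  rcases mul_eq_zero.1 this with h3 | h3
  · exact h3
  · exact absurd (C_eq_zero.1 h3) hr0

/-- The function `u` has no primitive along the flow in the coordinate ring. Multiplying the first
component by `2 b`, with `b = z.im ≠ 0`, gives `((u³ + E) b²)' = 2 r u b`, whose left side has the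
larger degree. -/
lemma LevelRing.eq_zero_of_deriv_eq_mul_X {z : LevelRing E} {r : ℝ}
    (h : z′ = ⟨C r * X, 0⟩) : r = 0 := by
  have h2 := two_mul_C_three_halves
  have hre : C (3 / 2) * X ^ 2 * z.im + (X ^ 3 + C E) * derivative z.im = C r * X :=
    congrArg QuadraticAlgebra.re h
  by_cases hb : z.im = 0
  · rw [hb] at hre
    have : C r * X = (0 : ℝ[X]) := by simpa using hre.symm
    simpa using this
  · exfalso
    have hd : derivative ((X ^ 3 + C E) * z.im ^ 2) = C (2 * r) * X * z.im := by
      simp only [derivative_pow, derivative_mul, derivative_add, derivative_X, derivative_C]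
      rw [Polynomial.C_mul, C_two_eq]
      simp
      rw [C_two_eq, C_three_eq]
      linear_combination 2 * z.im * hre - X ^ 2 * z.im ^ 2 * h2
    have h3 := natDegree_cubic_mul_sq (E := E) hb
    have h4 := natDegree_derivative ((X ^ 3 + C E) * z.im ^ 2)
    have h5 : (C (2 * r) * X * z.im).natDegree ≤ 1 + z.im.natDegree :=
      natDegree_mul_le.trans (Nat.add_le_add_right ((natDegree_C_mul_le _ _).trans natDegree_X_le) _)
    rw [← hd, h4] at h5
    omega

/-- The field does not raise the degree in `x`, so the cofactor is free of `x`. The leading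
coefficient is an eigenvector of the derivation, hence a constant `r ≠ 0` with cofactor `0`. In
degree `m + 1` the next coefficient would have derivative `-(m + 1) r u`, which is impossible. -/
lemma LevelRing.eq_const_of_invariant {f K : (LevelRing E)[X]} (hf : f ≠ 0)
    (h : Differential.mapCoeffs f + C (⟨X, 0⟩ : LevelRing E) * derivative f = K * f) :
    ∃ r : ℝ, f = C ⟨C r, 0⟩ := by
  have hcoeff : ∀ k, (f.coeff k)′ + ⟨X, 0⟩ * (f.coeff (k + 1) * (k + 1)) = (K * f).coeff k :=
    fun k => by
      rw [← h, coeff_add, Differential.coeff_mapCoeffs, coeff_C_mul, coeff_derivative]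
  have hle : (K * f).natDegree ≤ f.natDegree := by
    refine natDegree_le_iff_coeff_eq_zero.2 fun k hk => ?_
    rw [← hcoeff, coeff_eq_zero_of_natDegree_lt hk, coeff_eq_zero_of_natDegree_lt (hk.trans
      (Nat.lt_succ_self k))]
    simp
  obtain ⟨κ, hκ⟩ : ∃ κ, K = C κ := by
    by_cases hK : K = 0
    · exact ⟨0, by simp [hK]⟩
    · rw [natDegree_mul hK hf] at hle
      exact ⟨_, eq_C_of_natDegree_eq_zero (by omega)⟩
  subst hκ
  simp only [coeff_C_mul] at hcoeff
  have htop := hcoeff f.natDegree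
  rw [coeff_eq_zero_of_natDegree_lt (Nat.lt_succ_self _), zero_mul, mul_zero, add_zero] at htop
  obtain ⟨rfl, r, hr0, hr⟩ := LevelRing.eq_const_of_deriv_eq_mul
    (leadingCoeff_ne_zero.2 hf) htop
  have hdeg : f.natDegree = 0 := by
    by_contra hne
    obtain ⟨m, hm⟩ := Nat.exists_eq_succ_of_ne_zero hne
    have hlow := hcoeff m
    rw [leadingCoeff, hm] at hr
    rw [← Nat.succ_eq_add_one, hr, zero_mul] at hlow
    have hz : (f.coeff m)′ = ⟨C (-(r * (m + 1))) * X, 0⟩ := by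
      rw [eq_neg_of_add_eq_zero_left hlow]
      ext1 <;> simp
      ring
    have := LevelRing.eq_zero_of_deriv_eq_mul_X hz
    rw [neg_eq_zero, mul_eq_zero] at this
    rcases this with h1 | h1
    · exact hr0 h1
    · exact (Nat.cast_add_one_ne_zero m) h1
  refine ⟨r, ?_⟩
  rw [← hr, leadingCoeff, hdeg]
  exact eq_C_of_natDegree_eq_zero hdeg

/-- Evaluation of `z` at the point `(u, v)` of the curve `v² = u³ + E`. -/
noncomputable def LevelRing.evalAt {u v : ℝ} (h : v ^ 2 = u ^ 3 + E) : LevelRing E →+* ℝ where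
  toFun z := z.re.eval u + z.im.eval u * v
  map_one' := by simp
  map_zero' := by simp
  map_add' z w := by simp; ring
  map_mul' z w := by
    simp
    linear_combination (-z.im.eval u * w.im.eval u) * h

/-- Restriction of polynomials in `(x, u, v)` to the level `v² = u³ + E`. -/
noncomputable def restrictLevel (E : ℝ) : MvPolynomial (Fin 3) ℝ →ₐ[ℝ] (LevelRing E)[X] :=
  MvPolynomial.aeval ![X, C ⟨X, 0⟩, C ⟨0, 1⟩]

lemma eval_eq_eval_restrictLevel (f : MvPolynomial (Fin 3) ℝ) {p : Space}
    (hp : p 2 ^ 2 = p 1 ^ 3 + E) :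
    MvPolynomial.eval p f = (restrictLevel E f).eval₂ (LevelRing.evalAt hp) (p 0) := by
  have hhom : (MvPolynomial.eval p : MvPolynomial (Fin 3) ℝ →+* ℝ) =
      (eval₂RingHom (LevelRing.evalAt hp) (p 0)).comp (restrictLevel E).toRingHom := by
    refine MvPolynomial.ringHom_ext (fun r => ?_) fun i => ?_
    · have hr : (restrictLevel E) (MvPolynomial.C r) = C ⟨C r, 0⟩ := by
        rw [restrictLevel, ← MvPolynomial.algebraMap_eq, AlgHom.commutes]
        rfl
      simp [hr, LevelRing.evalAt]
    · fin_cases i <;> simp [restrictLevel, LevelRing.evalAt]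
  rw [hhom]
  rfl

/-- Since `v² - u³` is a first integral, the field descends to each level, where it is the
derivation of `LevelRing E` plus `u ∂/∂x`. -/
lemma restrictLevel_field (f : MvPolynomial (Fin 3) ℝ) :
    restrictLevel E (MvPolynomial.X 1 * MvPolynomial.pderiv 0 f +
        MvPolynomial.X 2 * MvPolynomial.pderiv 1 f +
        MvPolynomial.C (3 / 2) * MvPolynomial.X 1 ^ 2 * MvPolynomial.pderiv 2 f) =
      Differential.mapCoeffs (restrictLevel E f) +
        C (⟨X, 0⟩ : LevelRing E) * derivative (restrictLevel E f) := by
  have hC : ∀ r : ℝ, restrictLevel E (MvPolynomial.C r) = C ⟨C r, 0⟩ := fun r => by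
    rw [restrictLevel, ← MvPolynomial.algebraMap_eq, AlgHom.commutes]
    rfl
  have hX0 : restrictLevel E (MvPolynomial.X 0) = X := by simp [restrictLevel]
  have hX1 : restrictLevel E (MvPolynomial.X 1) = C ⟨X, 0⟩ := by simp [restrictLevel]
  have hX2 : restrictLevel E (MvPolynomial.X 2) = C ⟨0, 1⟩ := by simp [restrictLevel]
  induction f using MvPolynomial.induction_on with
  | C a =>
    have h0 : ((⟨C a, 0⟩ : LevelRing E))′ = 0 := by
      ext1
      · rw [LevelRing.deriv_re]; simp
      · rw [LevelRing.deriv_im]; simp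
    simp [hC, h0]
  | add f g hf hg =>
    simp only [map_add, mul_add] at hf hg ⊢
    linear_combination hf + hg
  | mul_X f j hf =>
    have d1 : ((⟨X, 0⟩ : LevelRing E))′ = ⟨0, 1⟩ := by
      ext1
      · rw [LevelRing.deriv_re]; simp
      · rw [LevelRing.deriv_im]; simp
    have d2 : ((⟨0, 1⟩ : LevelRing E))′ = ⟨C (3 / 2), 0⟩ * ⟨X, 0⟩ ^ 2 := by
      rw [sq]
      ext1
      · rw [LevelRing.deriv_re]; simp [sq]
      · rw [LevelRing.deriv_im]; simp
    simp only [Derivation.leibniz, map_add, map_mul, map_pow, hC, hX1, hX2, smul_eq_mul,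
      derivative_mul] at hf ⊢
    fin_cases j
    · simp [hX0, MvPolynomial.pderiv_X]
      linear_combination X * hf
    · simp [hX1, MvPolynomial.pderiv_X, d1]
      linear_combination C (⟨X, 0⟩ : LevelRing E) * hf
    · simp [hX2, MvPolynomial.pderiv_X, d2]
      linear_combination C (⟨0, 1⟩ : LevelRing E) * hf

/-- A polynomial defining an invariant algebraic surface of `x''' = (3/2) (x')²` is constant on
each level of the first integral `v² - u³`. -/
lemma exists_eval_eq_of_invariant {f K : MvPolynomial (Fin 3) ℝ}
    (h : ∀ p : Space, ∑ i, normalField (3 / 2) 0 p i * MvPolynomial.eval p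
      (MvPolynomial.pderiv i f) = MvPolynomial.eval p K * MvPolynomial.eval p f) (E : ℝ) :
    ∃ r : ℝ, ∀ p : Space, p 2 ^ 2 = p 1 ^ 3 + E → MvPolynomial.eval p f = r := by
  have hpoly : MvPolynomial.X 1 * MvPolynomial.pderiv 0 f +
      MvPolynomial.X 2 * MvPolynomial.pderiv 1 f +
      MvPolynomial.C (3 / 2) * MvPolynomial.X 1 ^ 2 * MvPolynomial.pderiv 2 f = K * f :=
    MvPolynomial.funext fun p => by
      have := h p
      rw [Fin.sum_univ_three] at this
      simpa [normalField] using this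
  have hres := restrictLevel_field (E := E) f
  rw [hpoly, map_mul] at hres
  by_cases h0 : restrictLevel E f = 0
  · exact ⟨0, fun p hp => by rw [eval_eq_eval_restrictLevel f hp, h0, eval₂_zero]⟩
  · obtain ⟨r, hr⟩ := LevelRing.eq_const_of_invariant h0 hres.symm
    refine ⟨r, fun p hp => ?_⟩
    rw [eval_eq_eval_restrictLevel f hp, hr, eval₂_C]
    simp [LevelRing.evalAt]

end LevelRing

end NilpotentField

namespace NilpotentField

open Filter Topology

/-! ### The cuspidal surface -/

/-- The first integral `v² - u³`. -/
def cuspFun (p : Space) : ℝ := p 2 ^ 2 - p 1 ^ 3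

lemma continuous_cuspFun : Continuous cuspFun := by unfold cuspFun; fun_prop

lemma mem_standardCuspidal {p : Space} : p ∈ standardCuspidal ↔ cuspFun p = 0 :=
  sub_eq_zero.symm

lemma isPreconnected_standardCuspidal : IsPreconnected standardCuspidal := by
  have h : standardCuspidal = Set.range fun q : ℝ × ℝ => (![q.1, q.2 ^ 2, q.2 ^ 3] : Space) := by
    ext p
    constructor
    · intro hp
      have hp : p 2 ^ 2 = p 1 ^ 3 := hp
      by_cases h1 : p 1 = 0
      · rw [h1] at hp
        have h2 : p 2 = 0 := by simpa using hp
        exact ⟨(p 0, 0), by ext i; fin_cases i <;> simp [h1, h2]⟩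
      · refine ⟨(p 0, p 2 / p 1), ?_⟩
        ext i
        fin_cases i
        · simp
        · simp [div_pow, hp]; field_simp
        · simp only [Fin.reduceFinMk, Matrix.cons_val, div_pow]
          rw [← hp]
          by_cases h2 : p 2 = 0
          · simp [h2]
          · field_simp
    · rintro ⟨q, rfl⟩
      change (q.2 ^ 3) ^ 2 = (q.2 ^ 2) ^ 3
      ring
  rw [h]
  refine isPreconnected_range (continuous_pi fun i => ?_)
  fin_cases i <;> simp <;> fun_prop

lemma interior_standardCuspidal : interior standardCuspidal = ∅ := by
  by_contra hne
  obtain ⟨p, hp⟩ := Set.nonempty_iff_ne_empty.2 hne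
  have hc : ContinuousAt (fun s : ℝ => p + s • (![0, 0, 1] : Space)) 0 := by fun_prop
  have h := hc.eventually (show standardCuspidal ∈ 𝓝 (p + (0 : ℝ) • (![0, 0, 1] : Space)) by
    simpa using mem_interior_iff_mem_nhds.1 hp)
  obtain ⟨ε, hε, h⟩ := Metric.eventually_nhds_iff.1 h
  -- Moving by `s` in the `v` direction changes `v²` by `s (s + 2 v)`, which vanishes for at most
  -- one `s > 0`.
  have hval : ∀ s : ℝ, 0 < s → s < ε → s + 2 * p 2 = 0 := fun s hs0 hs => by
    have h1 : p + s • (![0, 0, 1] : Space) ∈ standardCuspidal :=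
      h (by rw [Real.dist_eq, sub_zero, abs_of_pos hs0]; exact hs)
    have h2 : p ∈ standardCuspidal := interior_subset hp
    simp only [mem_standardCuspidal, cuspFun, Pi.add_apply, Pi.smul_apply, smul_eq_mul,
      Matrix.cons_val, Matrix.cons_val_one, Matrix.cons_val_zero, mul_zero, mul_one,
      add_zero] at h1 h2
    exact mul_left_cancel₀ hs0.ne' (by linear_combination h1 - h2)
  have h1 := hval (ε / 2) (by linarith) (by linarith)
  have h2 := hval (ε / 3) (by linarith) (by linarith)
  linarith

/-- The cuspidal edge is a critical point of every function with zero set `z² = y³`. -/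
lemma eq_zero_of_zeroSet_eq_standardCuspidal {G : Space → ℝ} (hG : Continuous G)
    (hzero : ∀ p, G p = 0 ↔ p ∈ standardCuspidal) {L : Space →L[ℝ] ℝ}
    (hL : HasFDerivAt G L 0) : L = 0 := by
  have hmem : ∀ p : Space, p 2 ^ 2 = p 1 ^ 3 → G p = 0 := fun p hp => (hzero p).2 hp
  have h0 : L ![1, 0, 0] = 0 := by
    have hc : HasDerivAt (fun s : ℝ => (![s, 0, 0] : Space)) ![1, 0, 0] 0 := by
      rw [hasDerivAt_pi]
      intro i
      fin_cases i
      · simpa using hasDerivAt_id' (0 : ℝ)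
      · simpa using hasDerivAt_const (0 : ℝ) (0 : ℝ)
      · simpa using hasDerivAt_const (0 : ℝ) (0 : ℝ)
    have hL' : HasFDerivAt G L ![(0 : ℝ), 0, 0] := by
      convert hL using 1; ext i; fin_cases i <;> simp
    have h1 := hL'.comp_hasDerivAt (0 : ℝ) hc
    refine h1.unique ((hasDerivAt_const (0 : ℝ) (0 : ℝ)).congr_of_eventuallyEq
      (Eventually.of_forall fun s => hmem _ (by simp)))
  have h1 : L ![0, 1, 0] = 0 := by
    -- For `s ≥ 0` this curve lies on the surface, so a one-sided derivative suffices.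
    have hc : HasDerivAt (fun s : ℝ => (![0, s, s ^ (3 / 2 : ℝ)] : Space)) ![0, 1, 0] 0 := by
      rw [hasDerivAt_pi]
      intro i
      fin_cases i
      · simpa using hasDerivAt_const (0 : ℝ) (0 : ℝ)
      · simpa using hasDerivAt_id' (0 : ℝ)
      · have := Real.hasDerivAt_rpow_const (x := 0) (p := 3 / 2) (Or.inr (by norm_num))
        rw [Real.zero_rpow (by norm_num), mul_zero] at this
        simpa using this
    have hL' : HasFDerivAt G L ![(0 : ℝ), 0, (0 : ℝ) ^ (3 / 2 : ℝ)] := by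
      convert hL using 1; ext i; fin_cases i <;> simp
    have h1 := (hL'.comp_hasDerivAt (0 : ℝ) hc).hasDerivWithinAt (s := Set.Ici 0)
    have h2 : HasDerivWithinAt (G ∘ fun s : ℝ => (![0, s, s ^ (3 / 2 : ℝ)] : Space)) 0
        (Set.Ici 0) 0 := by
      refine (hasDerivWithinAt_const (0 : ℝ) (Set.Ici 0) (0 : ℝ)).congr (fun s hs => ?_) ?_
      · refine hmem _ ?_
        simp only [Matrix.cons_val, Matrix.cons_val_one, Matrix.cons_val_zero]
        rw [← Real.rpow_natCast, ← Real.rpow_mul hs]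
        norm_num
      · exact hmem _ (by simp)
    exact (uniqueDiffWithinAt_Ici (0 : ℝ)).eq_deriv _ h1 h2
  -- Otherwise `G` changes sign along the third axis, and by continuity also along nearby parallels
  -- with `y < 0`, where `z² = y³` has no solution.
  have h2 : L ![0, 0, 1] = 0 := by
    by_contra hne
    obtain ⟨c, hc⟩ : ∃ c : ℝ, 0 < L ![0, 0, c] := by
      rcases lt_or_gt_of_ne hne with h | h
      · refine ⟨-1, ?_⟩
        have : (![0, 0, -1] : Space) = -![0, 0, 1] := by ext i; fin_cases i <;> simp
        rw [this, map_neg]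
        linarith
      · exact ⟨1, h⟩
    obtain ⟨η, hη, -, hη1, hη2⟩ := exists_sign_change hL (hmem 0 (by simp)) hc one_pos
    have hcont : ∀ s : ℝ, ContinuousAt (fun y : ℝ => G ![0, y, s * c]) 0 := fun s => by
      refine hG.continuousAt.comp (Continuous.continuousAt (continuous_pi fun i => ?_))
      fin_cases i <;> simp <;> fun_prop
    have hval : ∀ s : ℝ, (0 : Space) + s • (![0, 0, c] : Space) = ![0, 0, s * c] := fun s => by
      ext i; fin_cases i <;> simp
    rw [hval] at hη1 hη2
    have e := ((hcont η).eventually (lt_mem_nhds hη1)).and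
      ((hcont (-η)).eventually (gt_mem_nhds hη2))
    obtain ⟨ε, hε, he⟩ := Metric.eventually_nhds_iff.1 e
    obtain ⟨hy1, hy2⟩ := @he (-(ε / 2)) (by
      rw [Real.dist_eq, sub_zero, abs_neg, abs_of_pos (half_pos hε)]; linarith)
    have hline : Continuous fun s : ℝ => G ![0, -(ε / 2), s * c] := by
      refine hG.comp (continuous_pi fun i => ?_)
      fin_cases i <;> simp <;> fun_prop
    obtain ⟨s, -, hs⟩ := intermediate_value_Icc (show -η ≤ η by linarith) hline.continuousOn
      (show (0 : ℝ) ∈ _ from ⟨hy2.le, hy1.le⟩)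
    have hm : (s * c) ^ 2 = (-(ε / 2)) ^ 3 := (hzero _).1 hs
    have : 0 < (ε / 2) ^ 3 := by positivity
    nlinarith [sq_nonneg (s * c)]
  refine ContinuousLinearMap.ext fun w => ?_
  have hw : w = w 0 • (![1, 0, 0] : Space) + w 1 • (![0, 1, 0] : Space) +
      w 2 • (![0, 0, 1] : Space) := by
    ext i; fin_cases i <;> simp
  rw [hw, map_add, map_add, map_smul, map_smul, map_smul, h0, h1, h2]
  simp

lemma isInvariantAlgebraic_standardCuspidal :
    IsInvariantAlgebraic (normalField (3 / 2) 0) standardCuspidal := by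
  refine ⟨MvPolynomial.X 2 ^ 2 - MvPolynomial.X 1 ^ 3, 0, fun h => ?_, ?_, fun p => ?_⟩
  · rw [MvPolynomial.totalDegree_eq_zero_iff_eq_C] at h
    have h0 := congrArg (MvPolynomial.eval (![0, 0, 0] : Space)) h
    have h1 := congrArg (MvPolynomial.eval (![0, 0, 1] : Space)) h
    rw [MvPolynomial.eval_C] at h0 h1
    simp [← h0] at h1
  · ext p
    rw [mem_standardCuspidal]
    simp [cuspFun]
  · rw [Fin.sum_univ_three]
    simp [normalField, MvPolynomial.pderiv_X]
    ring

lemma isCuspidal_standardCuspidal : IsCuspidal standardCuspidal :=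
  ⟨Equiv.refl _, contDiff_id, contDiff_id, by simp⟩

/-- A smooth level of `v² - u³` is not cuspidal. -/
lemma eq_zero_of_isCuspidal_level {h : ℝ} (hS : IsCuspidal {p | cuspFun p = h}) : h = 0 := by
  obtain ⟨e, he, he', heS⟩ := hS
  set p₀ := e.symm 0
  have hiff : ∀ q, cuspFun (e.symm q) = h ↔ q ∈ standardCuspidal := fun q => by
    rw [← heS, e.image_eq_preimage_symm]
    exact Iff.rfl
  have hp₀ : cuspFun p₀ = h := (hiff 0).2 (by simp [standardCuspidal])
  have hsm : ContDiff ℝ 1 cuspFun := by unfold cuspFun; fun_prop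
  -- In the straightened coordinates the level function has a critical point at the origin, so
  -- `cuspFun` is critical at `p₀`; this means `u = v = 0` there.
  have hG : ContDiff ℝ 1 fun q => cuspFun (e.symm q) - h :=
    (hsm.comp (he'.of_le (by simp))).sub contDiff_const
  have hG0 : HasFDerivAt (fun q => cuspFun (e.symm q) - h) (0 : Space →L[ℝ] ℝ) 0 := by
    have hd := (hG.differentiable one_ne_zero 0).hasFDerivAt
    have := eq_zero_of_zeroSet_eq_standardCuspidal hG.continuous
      (fun q => by rw [sub_eq_zero, hiff]) hd
    rwa [this] at hd
  have hcusp : HasFDerivAt cuspFun (0 : Space →L[ℝ] ℝ) p₀ := by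
    have h1 : HasFDerivAt (fun q => cuspFun (e.symm q) - h) (0 : Space →L[ℝ] ℝ) (e p₀) := by
      simpa [p₀] using hG0
    have h2 := (h1.comp p₀ (he.differentiable (by simp) p₀).hasFDerivAt).add_const h
    simpa [Function.comp_def] using h2
  have hline : ∀ w : Space, HasDerivAt (fun s : ℝ => cuspFun (p₀ + s • w)) 0 0 := fun w => by
    have h1 : HasDerivAt (fun s : ℝ => p₀ + s • w) w 0 := by
      simpa using ((hasDerivAt_id (0 : ℝ)).smul_const w).const_add p₀
    have h2 : HasFDerivAt cuspFun (0 : Space →L[ℝ] ℝ) (p₀ + (0 : ℝ) • w) := by simpa using hcusp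
    exact h2.comp_hasDerivAt 0 h1
  have hv := hline ![0, 0, 1]
  have hu := hline ![0, 1, 0]
  simp only [cuspFun, Pi.add_apply, Pi.smul_apply, smul_eq_mul, Matrix.cons_val,
    Matrix.cons_val_one, Matrix.cons_val_zero, mul_zero, mul_one, add_zero] at hv hu
  have hid := hasDerivAt_id (0 : ℝ)
  have e1 := hv.unique (((hid.const_add (p₀ 2)).pow 2).sub_const (p₀ 1 ^ 3))
  have e2 := hu.unique (((hid.const_add (p₀ 1)).pow 3).const_sub (p₀ 2 ^ 2))
  simp at e1 e2
  rw [← hp₀, cuspFun, e1, e2]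
  simp

/-- `S` is a union of levels of `cuspFun`. Two different levels in the connected set `S` would bring
in the open set of all levels between them, against its empty interior. -/
lemma eq_standardCuspidal {S : Set Space}
    (hS : IsCuspidalInvariantSurface (normalField (3 / 2) 0) S) : S = standardCuspidal := by
  obtain ⟨⟨f, K, -, hSf, hK⟩, hcusp⟩ := hS
  have hlevel : ∀ p q : Space, cuspFun p = cuspFun q → p ∈ S → q ∈ S := fun p q hpq hp => by
    obtain ⟨r, hr⟩ := exists_eval_eq_of_invariant hK (cuspFun p)
    rw [hSf] at hp ⊢
    have hp : MvPolynomial.eval p f = 0 := hp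
    change MvPolynomial.eval q f = 0
    rw [hr q (by rw [hpq, cuspFun]; ring), ← hr p (by rw [cuspFun]; ring), hp]
  obtain ⟨e, he, he', heS⟩ := id hcusp
  have hSe : S = e.symm '' standardCuspidal := by rw [← heS, Equiv.symm_image_image]
  have hconn : IsPreconnected S := by
    rw [hSe]
    exact isPreconnected_standardCuspidal.image _ he'.continuous.continuousOn
  have hint : interior S = ∅ := by
    let E : Space ≃ₜ Space := ⟨e, he.continuous, he'.continuous⟩
    have : E.symm '' interior standardCuspidal = interior (E.symm '' standardCuspidal) :=
      E.symm.image_interior _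
    rw [hSe]
    rw [interior_standardCuspidal, Set.image_empty] at this
    exact this.symm
  have hne : S.Nonempty := by
    rw [hSe]
    exact ⟨_, 0, by simp [standardCuspidal], rfl⟩
  obtain ⟨p₀, hp₀⟩ := hne
  have hno : ∀ p ∈ S, ∀ q ∈ S, ¬ cuspFun p < cuspFun q := fun p hp q hq hlt => by
    have himg := (hconn.image cuspFun continuous_cuspFun.continuousOn).ordConnected
    have hsub : cuspFun ⁻¹' Set.Ioo (cuspFun p) (cuspFun q) ⊆ S := fun x hx => by
      obtain ⟨y, hy, hxy⟩ := himg.out ⟨p, hp, rfl⟩ ⟨q, hq, rfl⟩ (Set.Ioo_subset_Icc_self hx)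
      exact hlevel y x hxy hy
    have hsub' := interior_maximal hsub (isOpen_Ioo.preimage continuous_cuspFun)
    rw [hint] at hsub'
    obtain ⟨m, hm⟩ := exists_between hlt
    obtain ⟨y, -, hy⟩ := himg.out ⟨p, hp, rfl⟩ ⟨q, hq, rfl⟩ (Set.Ioo_subset_Icc_self hm)
    exact hsub' (show y ∈ cuspFun ⁻¹' _ by rw [Set.mem_preimage, hy]; exact hm)
  have hSlevel : S = {p | cuspFun p = cuspFun p₀} := by
    ext p
    refine ⟨fun hp => ?_, fun hp => hlevel p₀ p hp.symm hp₀⟩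
    exact le_antisymm (not_lt.1 (hno p₀ hp₀ p hp)) (not_lt.1 (hno p hp p₀ hp₀))
  have h0 : cuspFun p₀ = 0 := eq_zero_of_isCuspidal_level (hSlevel ▸ hcusp)
  rw [hSlevel, h0]
  ext p
  exact mem_standardCuspidal.symm

/-! ### Escape of the trajectories of the normal form for `a b ≥ 0` -/

section Escape

variable {γ : ℝ → Space} {I : Set ℝ}

lemma escapesBothWays_of_pos {b : ℝ} (hb : 0 < b) (h : IsTrajectory (normalField (3 / 2) b) γ I) :
    EscapesBothWays γ I := by
  have hs : (∀ s : ℝ, 0 ≤ 3 / 2 * s ^ 2 + b) ∨ (∀ s : ℝ, 3 / 2 * s ^ 2 + b ≤ 0) :=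
    Or.inl fun s => by positivity
  exact escapesBothWays_of_not_returnsForward
    (fun hr => hb.ne' (h.tendsto_of_forcing_sign hr hs).1)
    (fun hr => hb.ne' (h.reverse.tendsto_of_forcing_sign hr hs).1)

/-- The first integral tends to `0` because `u, v → 0`, and it is constant. -/
lemma IsTrajectory.mem_standardCuspidal (h : IsTrajectory (normalField (3 / 2) 0) γ I)
    (hr : ReturnsForward γ I) {t : ℝ} (ht : t ∈ I) : γ t ∈ standardCuspidal := by
  obtain ⟨-, h1, h2⟩ := h.tendsto_of_forcing_sign hr (Or.inl fun s => by positivity)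
  have hlim : Tendsto (fun s => cuspFun (γ s)) atTop (𝓝 0) := by
    simpa [cuspFun] using (h2.pow 2).sub (h1.pow 3)
  have hI := h.Ici_subset (contDiff_normalField _ _) hr ht
  have hconst : (fun s => cuspFun (γ s)) =ᶠ[atTop] fun _ => cuspFun (γ t) := by
    filter_upwards [eventually_ge_atTop t] with s hs
    have := h.toIsSolutionOn.energy_eq (hI hs) ht
    norm_num at this
    exact this
  rw [NilpotentField.mem_standardCuspidal]
  exact tendsto_nhds_unique (tendsto_const_nhds.congr' hconst.symm) hlim

lemma escapesBothWays_of_notMem_standardCuspidal (h : IsTrajectory (normalField (3 / 2) 0) γ I)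
    (hS : ∀ t ∈ I, γ t ∉ standardCuspidal) : EscapesBothWays γ I := by
  obtain ⟨t, ht⟩ := h.nonempty
  refine escapesBothWays_of_not_returnsForward (fun hr => hS t ht (h.mem_standardCuspidal hr ht))
    fun hr => hS t ht ?_
  have := h.reverse.mem_standardCuspidal hr (t := -t) (by simpa using ht)
  simpa [reflect, standardCuspidal] using this

/-- Returning forces `b = 0` and `u, v → 0`. Then `v` is constant, so zero; hence `u` is constant,
so zero; hence `x` is constant. -/
lemma IsTrajectory.eq_of_linear {b : ℝ} (h : IsTrajectory (normalField 0 b) γ I)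
    (hr : ReturnsForward γ I) {s t : ℝ} (hs : s ∈ I) (ht : t ∈ I) : γ s = γ t := by
  have hsign : (∀ s : ℝ, 0 ≤ 0 * s ^ 2 + b) ∨ (∀ s : ℝ, 0 * s ^ 2 + b ≤ 0) := by
    rcases le_total 0 b with h | h
    · exact Or.inl fun s => by simpa using h
    · exact Or.inr fun s => by simpa using h
  obtain ⟨rfl, h1, h2⟩ := h.tendsto_of_forcing_sign hr hsign
  have hI := h.Ici_subset (contDiff_normalField _ _) hr hs
  have hd := fun q (hq : q ∈ I) => hasDerivAt_normalField_iff.1 (h.hasDerivAt q hq)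
  have hzero : ∀ i : Fin 3, (∀ q ∈ I, HasDerivAt (fun s => γ s i) 0 q) →
      Tendsto (fun s => γ s i) atTop (𝓝 0) → ∀ q ∈ I, γ q i = 0 := fun i hi hl q hq => by
    have hc : (fun t => γ t i) =ᶠ[atTop] fun _ => γ q i := by
      filter_upwards [eventually_ge_atTop s] with t hst
      exact eq_of_hasDerivAt_zero h.isOpen h.ordConnected hi (hI hst) hq
    exact tendsto_nhds_unique (tendsto_const_nhds.congr' hc.symm) hl
  have hv := hzero 2 (fun q hq => by simpa using (hd q hq).2.2) h2
  have hu := hzero 1 (fun q hq => by simpa [hv q hq] using (hd q hq).2.1) h1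
  have hx : γ s 0 = γ t 0 := eq_of_hasDerivAt_zero h.isOpen h.ordConnected
    (f := fun s => γ s 0) (fun q hq => by simpa [hu q hq] using (hd q hq).1) hs ht
  ext i
  fin_cases i
  · exact hx
  · simp [hu s hs, hu t ht]
  · simp [hv s hs, hv t ht]

lemma escapesBothWays_of_linear {b : ℝ} (h : IsTrajectory (normalField 0 b) γ I)
    (hn : IsNontrivial γ I) : EscapesBothWays γ I := by
  obtain ⟨s, hs, t, ht, hne⟩ := hn
  refine escapesBothWays_of_not_returnsForward (fun hr => hne (h.eq_of_linear hr hs ht))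
    fun hr => hne ?_
  have := h.reverse.eq_of_linear hr (s := -s) (t := -t) (by simpa using hs) (by simpa using ht)
  simpa [reflect_reflect] using congrArg reflect this

end Escape

end NilpotentField

namespace NilpotentField

/-! ### Reduction to the normal form -/

lemma IsConj.isCuspidal {e : Space ≃ Space} {F G : Space → Space} (h : IsConj e F G)
    {S : Set Space} (hS : IsCuspidal S) : IsCuspidal (e '' S) := by
  obtain ⟨d, hd, hd', hdS⟩ := hS
  refine ⟨e.symm.trans d, hd.comp h.smooth_symm, h.smooth.comp hd', ?_⟩
  rw [← hdS, ← Set.image_comp]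
  ext q
  simp

/-- The vector field in terms of the coefficients: `F₁ = p y + e₀ + e₁ x + e₂ x²` and
`P₂(z + A₂(x) / p_{d₂}) = q z + d₀ + d₁ x`. -/
noncomputable def explicitField (p q e₀ e₁ e₂ d₀ d₁ A₃ : ℝ) (s : Space) : Space :=
  ![p * s 1 + e₀ + e₁ * s 0 + e₂ * s 0 ^ 2,
    q * s 2 + d₀ + d₁ * s 0 -
      (e₁ + 2 * e₂ * s 0) / p * (p * s 1 + e₀ + e₁ * s 0 + e₂ * s 0 ^ 2),
    e₂ / (p * q) * (p * s 1 + e₀ + e₁ * s 0 + e₂ * s 0 ^ 2) ^ 2 -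
      d₁ / q * (p * s 1 + e₀ + e₁ * s 0 + e₂ * s 0 ^ 2) + A₃]

section Straighten

variable {l p q e₀ e₁ e₂ d₀ d₁ A₃ : ℝ}

/-- The coordinates `(l x, l x', l x'')`. -/
noncomputable def straighten (e₀ e₁ e₂ d₀ d₁ : ℝ) (hl : l ≠ 0) (hp : p ≠ 0) (hq : q ≠ 0) :
    Space ≃ Space where
  toFun s := ![l * s 0, l * (p * s 1 + e₀ + e₁ * s 0 + e₂ * s 0 ^ 2),
    l * p * (q * s 2 + d₀ + d₁ * s 0)]
  invFun s := ![l⁻¹ * s 0,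
    p⁻¹ * (l⁻¹ * s 1 - e₀ - e₁ * (l⁻¹ * s 0) - e₂ * (l⁻¹ * s 0) ^ 2),
    q⁻¹ * ((l * p)⁻¹ * s 2 - d₀ - d₁ * (l⁻¹ * s 0))]
  left_inv s := by
    ext i
    fin_cases i <;> simp <;> field_simp <;> ring
  right_inv s := by
    ext i
    fin_cases i <;> simp <;> field_simp <;> ring

lemma isPolynomialMap_straighten (hl : l ≠ 0) (hp : p ≠ 0) (hq : q ≠ 0) :
    IsPolynomialMap (straighten e₀ e₁ e₂ d₀ d₁ hl hp hq) := by
  open MvPolynomial in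
  refine ⟨![C l * X 0, C l * (C p * X 1 + C e₀ + C e₁ * X 0 + C e₂ * X 0 ^ 2),
    C (l * p) * (C q * X 2 + C d₀ + C d₁ * X 0)], fun s i => ?_⟩
  fin_cases i <;> simp [straighten]

lemma isPolynomialMap_straighten_symm (hl : l ≠ 0) (hp : p ≠ 0) (hq : q ≠ 0) :
    IsPolynomialMap (straighten e₀ e₁ e₂ d₀ d₁ hl hp hq).symm := by
  open MvPolynomial in
  refine ⟨![C l⁻¹ * X 0,
    C p⁻¹ * (C l⁻¹ * X 1 - C e₀ - C e₁ * (C l⁻¹ * X 0) - C e₂ * (C l⁻¹ * X 0) ^ 2),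
    C q⁻¹ * (C (l * p)⁻¹ * X 2 - C d₀ - C d₁ * (C l⁻¹ * X 0))], fun s i => ?_⟩
  fin_cases i <;> simp [straighten]

lemma IsPolynomialMap.contDiff {e : Space → Space} (h : IsPolynomialMap e) {n : WithTop ℕ∞} :
    ContDiff ℝ n e := by
  obtain ⟨Q, hQ⟩ := h
  rw [contDiff_pi]
  intro i
  simp only [hQ]
  generalize Q i = f
  induction f using MvPolynomial.induction_on with
  | C a => simpa using contDiff_const
  | add f g hf hg => simpa using hf.add hg
  | mul_X f j hf => simpa using hf.mul (contDiff_apply ℝ ℝ j)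

/-- The choice of `F₂` gives `x'' = p (q z + d₀ + d₁ x)`, and in `x'''` the linear terms in `x'`
cancel, leaving `e₂ (x')² + p q A₃`. Scaling by `l` divides the quadratic coefficient by `l` and
multiplies the constant by `l`. -/
lemma isConj_straighten (hl : l ≠ 0) (hp : p ≠ 0) (hq : q ≠ 0) :
    IsConj (straighten e₀ e₁ e₂ d₀ d₁ hl hp hq) (explicitField p q e₀ e₁ e₂ d₀ d₁ A₃)
      (normalField (e₂ / l) (l * p * q * A₃)) := by
  have hsm : ContDiff ℝ ∞ (straighten e₀ e₁ e₂ d₀ d₁ hl hp hq) :=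
    (isPolynomialMap_straighten hl hp hq).contDiff
  refine ⟨hsm, (isPolynomialMap_straighten_symm hl hp hq).contDiff, fun s => ?_⟩
  set v := explicitField p q e₀ e₁ e₂ d₀ d₁ A₃ s with hv
  have hline : HasDerivAt (fun t : ℝ => s + t • v) v 0 := by
    simpa using ((hasDerivAt_id (0 : ℝ)).smul_const v).const_add s
  have hfd : HasFDerivAt (straighten e₀ e₁ e₂ d₀ d₁ hl hp hq)
      (fderiv ℝ (straighten e₀ e₁ e₂ d₀ d₁ hl hp hq) s) (s + (0 : ℝ) • v) := by
    simpa using (hsm.differentiable (by simp) s).hasFDerivAt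
  refine (hfd.comp_hasDerivAt (0 : ℝ) hline).unique (hasDerivAt_pi.2 fun i => ?_)
  have hc : ∀ j, HasDerivAt (fun t : ℝ => s j + t * v j) (v j) 0 := fun j => by
    simpa using ((hasDerivAt_id (0 : ℝ)).mul_const (v j)).const_add (s j)
  have v0 : v 0 = p * s 1 + e₀ + e₁ * s 0 + e₂ * s 0 ^ 2 := rfl
  have v1 : v 1 = q * s 2 + d₀ + d₁ * s 0 - (e₁ + 2 * e₂ * s 0) / p * v 0 := rfl
  have v2 : v 2 = e₂ / (p * q) * v 0 ^ 2 - d₁ / q * v 0 + A₃ := rfl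
  fin_cases i
  · refine ((hc 0).const_mul l).congr_deriv ?_
    change l * v 0 = l * (p * s 1 + e₀ + e₁ * s 0 + e₂ * s 0 ^ 2)
    rw [v0]
  · refine ((((((hc 1).const_mul p).add_const e₀).add ((hc 0).const_mul e₁)).add
      (((hc 0).pow 2).const_mul e₂)).const_mul l).congr_deriv ?_
    change _ = l * p * (q * s 2 + d₀ + d₁ * s 0)
    rw [v1]
    generalize v 0 = w
    simp
    field_simp
    ring
  · refine (((((hc 2).const_mul q).add_const d₀).add ((hc 0).const_mul d₁)).const_mul
      (l * p)).congr_deriv ?_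
    change _ = e₂ / l * (l * (p * s 1 + e₀ + e₁ * s 0 + e₂ * s 0 ^ 2)) ^ 2 + l * p * q * A₃
    rw [← v0, v2]
    generalize v 0 = w
    field_simp
    ring

end Straighten

open Polynomial in
lemma field_eq_explicitField {P₁ P₂ A₁ A₂ : ℝ[X]} (A₃ : ℝ) (hP₁ : P₁.natDegree = 1)
    (hP₂ : P₂.natDegree = 1) (hA₂ : A₂.natDegree ≤ 1) (hA₁ : A₁.natDegree ≤ 2) :
    field P₁ P₂ A₁ A₂ A₃ = explicitField P₁.leadingCoeff P₂.leadingCoeff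
      (P₁.leadingCoeff * A₁.coeff 0 + P₁.coeff 0) (P₁.leadingCoeff * A₁.coeff 1)
      (P₁.leadingCoeff * A₁.coeff 2) (A₂.coeff 0 + P₂.coeff 0) (A₂.coeff 1) A₃ := by
  have hp : P₁.leadingCoeff ≠ 0 := leadingCoeff_ne_zero.2 fun h => by simp [h] at hP₁
  have hq : P₂.leadingCoeff ≠ 0 := leadingCoeff_ne_zero.2 fun h => by simp [h] at hP₂
  have hevP₁ : ∀ s, P₁.eval s = P₁.leadingCoeff * s + P₁.coeff 0 := fun s => by
    rw [leadingCoeff, hP₁, eval_eq_sum_range, hP₁]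
    simp [Finset.sum_range_succ]; ring
  have hevP₂ : ∀ s, P₂.eval s = P₂.leadingCoeff * s + P₂.coeff 0 := fun s => by
    rw [leadingCoeff, hP₂, eval_eq_sum_range, hP₂]
    simp [Finset.sum_range_succ]; ring
  have hA₁' : A₁ = C (A₁.coeff 2) * X ^ 2 + C (A₁.coeff 1) * X + C (A₁.coeff 0) :=
    eq_quadratic_of_degree_le_two (natDegree_le_iff_degree_le.1 hA₁)
  have hA₂' : A₂ = C (A₂.coeff 1) * X + C (A₂.coeff 0) := eq_X_add_C_of_natDegree_le_one hA₂
  have hev₁ : ∀ x, A₁.eval x = A₁.coeff 2 * x ^ 2 + A₁.coeff 1 * x + A₁.coeff 0 := fun x => by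
    conv_lhs => rw [hA₁']
    simp
  have hdev₁ : ∀ x, A₁.derivative.eval x = 2 * A₁.coeff 2 * x + A₁.coeff 1 := fun x => by
    conv_lhs => rw [hA₁']
    simp; ring
  have hddev₁ : ∀ x, A₁.derivative.derivative.eval x = 2 * A₁.coeff 2 := fun x => by
    conv_lhs => rw [hA₁']
    simp; ring
  have hev₂ : ∀ x, A₂.eval x = A₂.coeff 1 * x + A₂.coeff 0 := fun x => by
    conv_lhs => rw [hA₂']
    simp
  have hdev₂ : ∀ x, A₂.derivative.eval x = A₂.coeff 1 := fun x => by
    conv_lhs => rw [hA₂']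
    simp
  funext s
  simp only [field, F₁, F₂, F₃, explicitField, hevP₁, hevP₂, hev₁, hdev₁, hddev₁, hev₂, hdev₂, hP₂]
  generalize P₁.leadingCoeff = p at *
  generalize P₂.leadingCoeff = q at *
  ext i
  fin_cases i <;> simp
  · ring
  · field_simp
    ring
  · field_simp
    ring

end NilpotentField

/-! ### Assembly of the theorem through the normal form -/

open NilpotentField in
theorem mainTheorem3 (P₁ P₂ A₁ A₂ : Polynomial ℝ) (A₃ : ℝ)
    (hP₁ : P₁.natDegree = 1) (hP₂ : P₂.natDegree = 1) (hA₂ : A₂.natDegree ≤ 1) :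
    (A₁.natDegree ≤ 1 →
      ∀ (γ : ℝ → NilpotentField.Space) (I : Set ℝ),
        NilpotentField.IsTrajectory (NilpotentField.field P₁ P₂ A₁ A₂ A₃) γ I →
        NilpotentField.IsNontrivial γ I → NilpotentField.EscapesBothWays γ I) ∧
    (A₁.natDegree = 2 →
      (0 < NilpotentField.mu P₁ P₂ A₁ A₃ →
        ∀ (γ : ℝ → NilpotentField.Space) (I : Set ℝ),
          NilpotentField.IsTrajectory (NilpotentField.field P₁ P₂ A₁ A₂ A₃) γ I →
          NilpotentField.EscapesBothWays γ I) ∧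
      (NilpotentField.mu P₁ P₂ A₁ A₃ = 0 →
        ∃ S₀ : Set NilpotentField.Space,
          NilpotentField.IsCuspidalInvariantSurface
            (NilpotentField.field P₁ P₂ A₁ A₂ A₃) S₀ ∧
          (∀ S : Set NilpotentField.Space,
            NilpotentField.IsCuspidalInvariantSurface
              (NilpotentField.field P₁ P₂ A₁ A₂ A₃) S → S = S₀) ∧
          ∀ (γ : ℝ → NilpotentField.Space) (I : Set ℝ),
            NilpotentField.IsTrajectory (NilpotentField.field P₁ P₂ A₁ A₂ A₃) γ I →
            (∀ t ∈ I, γ t ∉ S₀) → NilpotentField.EscapesBothWays γ I) ∧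
      (NilpotentField.mu P₁ P₂ A₁ A₃ < 0 →
        ∃ Sμ : Set NilpotentField.Space,
          NilpotentField.IsIsochronousPeriodicSurface
            (NilpotentField.field P₁ P₂ A₁ A₂ A₃) Sμ ∧
          Nonempty (Sμ ≃ₜ ℝ × Circle) ∧
          (∀ S : Set NilpotentField.Space,
            NilpotentField.IsIsochronousPeriodicSurface
              (NilpotentField.field P₁ P₂ A₁ A₂ A₃) S → S = Sμ) ∧
          ∀ (γ : ℝ → NilpotentField.Space) (I : Set ℝ),
            NilpotentField.IsTrajectory (NilpotentField.field P₁ P₂ A₁ A₂ A₃) γ I →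
            (∀ t ∈ I, γ t ∉ Sμ) → NilpotentField.EscapesBothWays γ I)) := by
  have hp : P₁.leadingCoeff ≠ 0 :=
    Polynomial.leadingCoeff_ne_zero.2 fun h => by simp [h] at hP₁
  have hq : P₂.leadingCoeff ≠ 0 :=
    Polynomial.leadingCoeff_ne_zero.2 fun h => by simp [h] at hP₂
  refine ⟨fun hA₁ γ I hγ hn => ?_, fun hA₁ => ?_⟩
  · rw [field_eq_explicitField A₃ hP₁ hP₂ hA₂ (hA₁.trans one_le_two),
      Polynomial.coeff_eq_zero_of_natDegree_lt (show A₁.natDegree < 2 by omega), mul_zero] at hγ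
    have hconj := isConj_straighten (e₀ := P₁.leadingCoeff * A₁.coeff 0 + P₁.coeff 0)
      (e₁ := P₁.leadingCoeff * A₁.coeff 1) (e₂ := 0) (d₀ := A₂.coeff 0 + P₂.coeff 0)
      (d₁ := A₂.coeff 1) (A₃ := A₃) one_ne_zero hp hq
    rw [zero_div] at hconj
    refine hconj.escapesBothWays (escapesBothWays_of_linear (hconj.isTrajectory hγ) ?_)
    obtain ⟨s, hs, t, ht, hne⟩ := hn
    exact ⟨s, hs, t, ht, fun heq => hne ((Equiv.injective _) heq)⟩
  · have ha : A₁.coeff 2 ≠ 0 := by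
      rw [← hA₁]
      exact Polynomial.leadingCoeff_ne_zero.2 fun h => by simp [h] at hA₁
    -- This scale normalizes the quadratic coefficient to `3/2` and turns the constant term into
    -- `2/3` of `μ`, so `b` has the sign of `μ`.
    have hl : 2 / 3 * (P₁.leadingCoeff * A₁.coeff 2) ≠ 0 :=
      mul_ne_zero (by norm_num) (mul_ne_zero hp ha)
    rw [field_eq_explicitField A₃ hP₁ hP₂ hA₂ hA₁.le]
    have hconj := isConj_straighten (e₀ := P₁.leadingCoeff * A₁.coeff 0 + P₁.coeff 0)
      (e₁ := P₁.leadingCoeff * A₁.coeff 1) (e₂ := P₁.leadingCoeff * A₁.coeff 2)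
      (d₀ := A₂.coeff 0 + P₂.coeff 0) (d₁ := A₂.coeff 1) (A₃ := A₃) hl hp hq
    rw [show P₁.leadingCoeff * A₁.coeff 2 / (2 / 3 * (P₁.leadingCoeff * A₁.coeff 2)) = 3 / 2 by
        field_simp,
      show 2 / 3 * (P₁.leadingCoeff * A₁.coeff 2) * P₁.leadingCoeff * P₂.leadingCoeff * A₃ =
        2 / 3 * mu P₁ P₂ A₁ A₃ by rw [mu]; ring] at hconj
    have hpoly := isPolynomialMap_straighten (e₀ := P₁.leadingCoeff * A₁.coeff 0 + P₁.coeff 0)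
      (e₁ := P₁.leadingCoeff * A₁.coeff 1) (e₂ := P₁.leadingCoeff * A₁.coeff 2)
      (d₀ := A₂.coeff 0 + P₂.coeff 0) (d₁ := A₂.coeff 1) hl hp hq
    have hpoly' := isPolynomialMap_straighten_symm
      (e₀ := P₁.leadingCoeff * A₁.coeff 0 + P₁.coeff 0)
      (e₁ := P₁.leadingCoeff * A₁.coeff 1) (e₂ := P₁.leadingCoeff * A₁.coeff 2)
      (d₀ := A₂.coeff 0 + P₂.coeff 0) (d₁ := A₂.coeff 1) hl hp hq
    generalize explicitField _ _ _ _ _ _ _ _ = F at *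
    generalize straighten _ _ _ _ _ hl hp hq = e at *
    refine ⟨fun hμ γ I hγ => ?_, fun hμ => ?_, fun hμ => ?_⟩
    · exact hconj.escapesBothWays
        (escapesBothWays_of_pos (by positivity) (hconj.isTrajectory hγ))
    · rw [hμ, mul_zero] at hconj
      refine ⟨e.symm '' standardCuspidal,
        ⟨hconj.symm.isInvariantAlgebraic hpoly isInvariantAlgebraic_standardCuspidal,
          hconj.symm.isCuspidal isCuspidal_standardCuspidal⟩, fun S hS => ?_, fun γ I hγ hS => ?_⟩
      · rw [← eq_standardCuspidal ⟨hconj.isInvariantAlgebraic hpoly' hS.1, hconj.isCuspidal hS.2⟩,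
          Equiv.symm_image_image]
      · refine hconj.escapesBothWays (escapesBothWays_of_notMem_standardCuspidal
          (hconj.isTrajectory hγ) fun t ht hm => hS t ht ⟨_, hm, ?_⟩)
        simp
    · obtain ⟨S, hS, ⟨φ⟩, huniq, hesc⟩ := normalField_of_neg
        (show 2 / 3 * mu P₁ P₂ A₁ A₃ < 0 by linarith)
      refine ⟨e.symm '' S, hconj.symm.isIsochronousPeriodicSurface hS, ⟨?_⟩, fun S' hS' => ?_,
        fun γ I hγ hI => ?_⟩
      · let E : Space ≃ₜ Space := ⟨e, hconj.smooth.continuous, hconj.smooth_symm.continuous⟩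
        exact (E.symm.image S).symm.trans φ
      · rw [← huniq _ (hconj.isIsochronousPeriodicSurface hS'), Equiv.symm_image_image]
      · refine hconj.escapesBothWays (hesc _ I (hconj.isTrajectory hγ)
          fun t ht hm => hI t ht ⟨_, hm, ?_⟩)
        simp
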